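/- **Setting.** Let $n\ge 1$ and let $X$ be a finite simplicial complex, with sets $X^{(k)}$ of $k$-simplices ($X^{(-1)}=\{\emptyset\}$), that is pure of dimension $n$, i.e. every simplex (including $\emptyset$) is contained in an $n$-simplex. Let $m$ be a weight function on $X$: $m(\tau)>0$ for every simplex $\tau$ (including $\emptyset$), and $m(\tau)=\sum_{\sigma\in X^{(k+1)},\,\tau\subset\sigma}m(\sigma)$ for all $\tau\in X^{(k)}$, $-1\le k\le n-1$. (For example, the homogeneous weight, equal to $1$ on every $n$-simplex.) Let $\Sigma(k)$ be the set of ordered $k$-simplices and $C^k(X,\mathbb R)$ the space of antisymmetric functions $\Sigma(k)\to\mathbb R$ for $k\geq -1$, with inner product $\langle\phi,\psi\rangle=\sum_{\tau\in\Sigma(k)}\frac{m(\tau)}{(k+1)!}\phi(\tau)\psi(\tau)$. Let $d_k:C^k\to C^{k+1}$ be the simplicial differential, $(d_k\phi)(v_0,\dots,v_{k+1})=\sum_i(-1)^i\phi(v_0,\dots,\widehat{v_i},\dots,v_{k+1})$, let $\delta_k=d_k^*$, and put $\Delta_k^+=\delta_kd_k$, $\Delta_k^-=d_{k-1}\delta_{k-1}$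 and $\widetilde H^k(X,\mathbb R)=\ker d_k/\operatorname{im}d_{k-1}$ for $k\ge 0$ (for $k=0$, $d_{-1}$ sends a real number to the constant $0$-form). For a simplex $\tau$ of dimension at most $n-1$, the link $X_\tau$ consists of the simplices $\sigma$ disjoint from $\tau$ with $\tau\cup\sigma$ a simplex of $X$ (so $X_\emptyset=X$); it has the weight $m_\tau(\sigma)=m(\tau\cup\sigma)$, and $\Delta^+_{\tau,0}$ denotes its operator $\Delta_0^+$. **Theorem.** Suppose that all links of $X$ of positive dimension, including $X_\emptyset=X$, are connected. Let $\lambda>\frac{n-1}{n}$ be such that $\operatorname{Spec}(\Delta_{\tau,0}^+)\setminus\{0\}\subseteq[\lambda,\infty)$ for every $\tau\in X^{(n-2)}$ (i.e. for every $1$-dimensional link; for $n=1$ this is a condition on the graph $X$ itself). Let $f(x)=2-\frac1x$, let $f^j$ be its $j$-fold iterate ($f^0(x)=x$), and put $a_{n,k}(x)=(k+1)f^{\,n-1-k}(x)-k$. Then for every $0\le k\le n-1$: 1. $\widetilde H^k(X,\mathbb R)=0$. 2. $C^k(X,\mathbb R)=\ker\Delta_k^+\oplus\ker\Delta_k^-$,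 and this decomposition is orthogonal. 3. $\operatorname{Spec}(\Delta_k^+)\setminus\{0\}\subseteq[a_{n,k}(\lambda),\infty)$ and $\operatorname{Spec}(\Delta_{k+1}^-)\setminus\{0\}\subseteq[a_{n,k}(\lambda),\infty)$. 4. If moreover $\kappa\ge\lambda$ is such that $\operatorname{Spec}(\Delta_{\tau,0}^+)\setminus\{0\}\subseteq[\lambda,\kappa]$ for every $\tau\in X^{(n-2)}$, then $$\operatorname{Spec}(\Delta_k^+)\setminus\{0\}\subseteq[a_{n,k}(\lambda),a_{n,k}(\kappa)]\quad\text{and}\quad \operatorname{Spec}(\Delta_{k+1}^-)\setminus\{0\}\subseteq[a_{n,k}(\lambda),a_{n,k}(\kappa)].$$ 5. $\lim_{x\to1}a_{n,k}(x)=1$. -/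

import Mathlib

open Topology

/-- The simplices of a finite abstract simplicial complex, including the empty simplex `∅`
(the unique simplex of dimension `-1`). A simplex of dimension `k` is one with `k + 1` vertices. -/
def IsSimplex {V : Type*} (K : PreAbstractSimplicialComplex V) (s : Finset V) : Prop :=
  s = ∅ ∨ s ∈ K.faces

theorem IsSimplex.subset {V : Type*} {K : PreAbstractSimplicialComplex V} {s t : Finset V}
    (hs : IsSimplex K s) (hts : t ⊆ s) : IsSimplex K t := by
  rcases t.eq_empty_or_nonempty with h | h
  · exact Or.inl h
  · rcases hs with hs | hs
    · subst hs
      exact Or.inl (Finset.subset_empty.mp hts)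
    · exact Or.inr ((K.isRelLowerSet_faces hs).2 hts h)

/-- The link of `τ`: the nonempty `σ` disjoint from `τ` such that `τ ∪ σ` is a simplex. -/
def linkComplex {V : Type*} [DecidableEq V] (K : PreAbstractSimplicialComplex V) (τ : Finset V) :
    PreAbstractSimplicialComplex V where
  faces := {σ | σ.Nonempty ∧ Disjoint τ σ ∧ τ ∪ σ ∈ K.faces}
  isRelLowerSet_faces := by
    rintro σ ⟨hne, hd, hm⟩
    refine ⟨hne, fun ρ hρ hρne => ⟨hρne, Disjoint.mono_right hρ hd, ?_⟩⟩
    exact (K.isRelLowerSet_faces hm).2 (Finset.union_subset_union_right hρ)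
      (hρne.mono Finset.subset_union_right)

theorem isSimplex_linkComplex {V : Type*} [DecidableEq V] {K : PreAbstractSimplicialComplex V}
    {τ : Finset V} (hτ : IsSimplex K τ) (σ : Finset V) :
    IsSimplex (linkComplex K τ) σ ↔ Disjoint τ σ ∧ IsSimplex K (τ ∪ σ) := by
  rcases σ.eq_empty_or_nonempty with h | h
  · subst h
    simpa [IsSimplex] using hτ
  · have h1 : σ ≠ ∅ := h.ne_empty
    have h2 : ¬ (τ ∪ σ = ∅) := (h.mono Finset.subset_union_right).ne_empty
    simp only [IsSimplex, h1, h2, false_or]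
    exact ⟨fun hh => hh.2, fun hh => ⟨h, hh⟩⟩

/-- The graph whose vertices are the vertices of the complex and whose edges are its
`1`-simplices. -/
def oneSkeleton {V : Type*} [DecidableEq V] (K : PreAbstractSimplicialComplex V) :
    SimpleGraph {v : V // {v} ∈ K.faces} where
  Adj u v := u ≠ v ∧ ({u.1, v.1} : Finset V) ∈ K.faces
  symm := ⟨fun u v h => ⟨h.1.symm, by rw [Finset.pair_comm]; exact h.2⟩⟩
  loopless := ⟨fun _ h => h.1 rfl⟩

/-- A simplicial complex is connected if its vertices are connected through edges. -/
def IsConnectedComplex {V : Type*} [DecidableEq V] (K : PreAbstractSimplicialComplex V) : Prop :=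
  (oneSkeleton K).Connected

/-- Ordered simplices on `j` vertices (dimension `j - 1`): injective `j`-tuples of vertices that
span a simplex. For `j = 0` there is exactly one, the empty one. -/
def OrdSimplex {V : Type*} (K : PreAbstractSimplicialComplex V) (j : ℕ) : Type _ :=
  {v : Fin j ↪ V // IsSimplex K (Finset.univ.map v)}

noncomputable instance {V : Type*} [Fintype V] (K : PreAbstractSimplicialComplex V) (j : ℕ) :
    Fintype (OrdSimplex K j) := by
  classical
  exact inferInstanceAs (Fintype {v : Fin j ↪ V // IsSimplex K (Finset.univ.map v)})

/-- The unordered simplex underlying an ordered simplex. -/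
def OrdSimplex.support {V : Type*} {K : PreAbstractSimplicialComplex V} {j : ℕ}
    (v : OrdSimplex K j) : Finset V :=
  Finset.univ.map v.1

/-- Reindexing: `(v_0, …, v_{j-1})` is sent to `(v_{e 0}, …, v_{e (i-1)})`. -/
def OrdSimplex.comp {V : Type*} {K : PreAbstractSimplicialComplex V} {i j : ℕ}
    (v : OrdSimplex K j) (e : Fin i ↪ Fin j) : OrdSimplex K i :=
  ⟨e.trans v.1, v.2.subset (by
    intro x hx
    simp only [Finset.mem_map, Finset.mem_univ, true_and, Function.Embedding.trans_apply] at hx ⊢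
    obtain ⟨a, rfl⟩ := hx
    exact ⟨e a, rfl⟩)⟩

/-- `(v_0, …, v_j) ↦ (v_0, …, v̂_i, …, v_j)`. -/
def OrdSimplex.face {V : Type*} {K : PreAbstractSimplicialComplex V} {j : ℕ}
    (v : OrdSimplex K (j + 1)) (i : Fin (j + 1)) : OrdSimplex K j :=
  v.comp (Fin.succAboveEmb i)

/-- Antisymmetric real functions on the ordered simplices with `j` vertices,
i.e. the space `C^{j-1}(K, ℝ)` of `(j-1)`-forms. -/
def antisymmetricForms {V : Type*} (K : PreAbstractSimplicialComplex V) (j : ℕ) :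
    Submodule ℝ (OrdSimplex K j → ℝ) where
  carrier := {φ | ∀ (π : Equiv.Perm (Fin j)) (v : OrdSimplex K j),
    φ (v.comp π.toEmbedding) = ((Equiv.Perm.sign π : ℤ) : ℝ) * φ v}
  add_mem' := by
    intro a b ha hb π v
    simp only [Pi.add_apply, ha π v, hb π v]
    ring
  zero_mem' := by
    intro π v
    simp
  smul_mem' := by
    intro c a ha π v
    simp only [Pi.smul_apply, ha π v, smul_eq_mul]
    ring

/-- For a permutation `π` and `i`, the permutation induced by `π` on the remaining indices, with
its sign. -/
theorem exists_perm_succAbove {j : ℕ} (π : Equiv.Perm (Fin (j + 1))) (i : Fin (j + 1)) :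
    ∃ ρ : Equiv.Perm (Fin j), (∀ k, π (i.succAbove k) = (π i).succAbove (ρ k)) ∧
      (-1 : ℤ) ^ (i : ℕ) * (Equiv.Perm.sign ρ : ℤ)
        = (Equiv.Perm.sign π : ℤ) * (-1) ^ (π i : ℕ) := by
  set C : Equiv.Perm (Fin (j + 1)) :=
    (π i).cycleRange * π * (i.cycleRange)⁻¹ with hC
  have h0 : C 0 = 0 := by
    simp [hC]
  obtain ⟨⟨p, ρ⟩, hρ⟩ := (Equiv.Perm.decomposeFin.symm).surjective C
  have hp : p = 0 := by
    rw [← hρ, Equiv.Perm.decomposeFin_symm_apply_zero] at h0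
    exact h0
  subst hp
  refine ⟨ρ, fun k => ?_, ?_⟩
  · have h1 : C k.succ = (ρ k).succ := by
      rw [← hρ, Equiv.Perm.decomposeFin_symm_apply_succ]
      simp
    have h2 : (i.cycleRange)⁻¹ k.succ = i.succAbove k := by
      rw [Equiv.Perm.inv_eq_iff_eq, Fin.cycleRange_succAbove]
    have h3 : (π i).cycleRange (π (i.succAbove k)) = (ρ k).succ := by
      rw [← h1, hC]
      simp only [Equiv.Perm.mul_apply, h2]
    rw [← Fin.cycleRange_succAbove (π i)] at h3
    exact (π i).cycleRange.injective h3
  · have h1 : Equiv.Perm.sign C = Equiv.Perm.sign ρ := by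
      rw [← hρ, Equiv.Perm.decomposeFin.symm_sign]
      simp
    rw [← h1, hC]
    simp only [map_mul, map_inv, Fin.sign_cycleRange, Units.val_mul, Int.units_inv_eq_self,
      Units.val_pow_eq_pow_val, Units.val_neg, Units.val_one]
    have h2 : ((-1 : ℤ) ^ (i : ℕ)) * (-1) ^ (i : ℕ) = 1 := by
      rw [← mul_pow]
      simp
    linear_combination ((-1 : ℤ) ^ (π i : ℕ) * (Equiv.Perm.sign π : ℤ)) * h2

/-- The differential `(dφ)(v_0, …, v_j) = ∑ i, (-1)^i φ(v_0, …, v̂_i, …, v_j)` from forms on ordered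
simplices with `j` vertices to forms on ordered simplices with `j + 1` vertices. -/
def formDifferential {V : Type*} (K : PreAbstractSimplicialComplex V) (j : ℕ) :
    antisymmetricForms K j →ₗ[ℝ] antisymmetricForms K (j + 1) where
  toFun φ := ⟨fun v => ∑ i : Fin (j + 1), (-1 : ℝ) ^ (i : ℕ) * φ.1 (v.face i), by
    intro π v
    rw [Finset.mul_sum, ← Equiv.sum_comp π]
    refine Finset.sum_congr rfl fun i _ => ?_
    obtain ⟨ρ, hρ, hsign⟩ := exists_perm_succAbove π i
    have hface : (v.comp π.toEmbedding).face i = (v.face (π i)).comp ρ.toEmbedding := by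
      apply Subtype.ext
      ext k
      exact congrArg v.1 (hρ k)
    rw [hface, φ.2 ρ]
    have hs : ((-1 : ℝ)) ^ (i : ℕ) * ((Equiv.Perm.sign ρ : ℤ) : ℝ)
        = ((Equiv.Perm.sign π : ℤ) : ℝ) * (-1) ^ (π i : ℕ) := by
      exact_mod_cast hsign
    linear_combination φ.1 (v.face (π i)) * hs⟩
  map_add' φ ψ := by
    apply Subtype.ext
    funext v
    simp [mul_add, Finset.sum_add_distrib]
  map_smul' c φ := by
    apply Subtype.ext
    funext v
    simp only [RingHom.id_apply, Submodule.coe_smul, Pi.smul_apply, smul_eq_mul, Finset.mul_sum]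
    exact Finset.sum_congr rfl fun i _ => by ring

theorem formDifferential_comp {V : Type*} (K : PreAbstractSimplicialComplex V) (j : ℕ) :
    formDifferential K (j + 1) ∘ₗ formDifferential K j = 0 := by
  ext φ v
  change ∑ i : Fin (j + 2), (-1 : ℝ) ^ (i : ℕ) *
    (∑ k : Fin (j + 1), (-1 : ℝ) ^ (k : ℕ) * φ.1 ((v.face i).face k)) = 0
  simp only [Finset.mul_sum]
  rw [← Fintype.sum_prod_type']
  refine Finset.sum_involution (fun p _ => (p.1.succAbove p.2, p.2.predAbove p.1))
    ?_ ?_ (fun _ _ => Finset.mem_univ _) ?_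
  · rintro ⟨i, k⟩ -
    have hface : (v.face (i.succAbove k)).face (k.predAbove i) = (v.face i).face k := by
      apply Subtype.ext
      ext l
      exact congrArg v.1 (Fin.succAbove_succAbove_succAbove_predAbove i k l)
    have hs : ((-1 : ℝ)) ^ ((i.succAbove k : ℕ) + (k.predAbove i : ℕ))
        = -(-1) ^ ((i : ℕ) + (k : ℕ)) := Fin.neg_one_pow_succAbove_add_predAbove i k
    rw [hface]
    rw [pow_add, pow_add] at hs
    linear_combination φ.1 ((v.face i).face k) * hs
  · rintro ⟨i, k⟩ - - h
    exact Fin.succAbove_ne i k (congrArg Prod.fst h)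
  · rintro ⟨i, k⟩ -
    exact Prod.ext (Fin.succAbove_succAbove_predAbove i k) (Fin.predAbove_predAbove_succAbove i k)

/-- A (finite, pure) weighted simplicial complex of dimension `dim`: every simplex, including `∅`,
lies in a simplex of dimension `dim`, and the weight is positive on simplices and balanced, i.e.
the weight of each simplex of dimension `< dim` is the sum of the weights of the simplices of one
dimension more that contain it. Values of `weight` off the simplices play no role. -/
structure WeightedComplex (V : Type*) [Fintype V] where
  /-- the dimension `n` -/
  dim : ℕ
  /-- the underlying simplicial complex -/
  complex : PreAbstractSimplicialComplex V
  pure : ∀ s, IsSimplex complex s → ∃ t, IsSimplex complex t ∧ s ⊆ t ∧ t.card = dim + 1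
  /-- the weight function `m` -/
  weight : Finset V → ℝ
  weight_pos : ∀ s, IsSimplex complex s → 0 < weight s
  weight_balanced : ∀ τ, IsSimplex complex τ → τ.card ≤ dim →
    (∑ᶠ σ ∈ {σ : Finset V | IsSimplex complex σ ∧ τ ⊆ σ ∧ σ.card = τ.card + 1}, weight σ)
      = weight τ

namespace WeightedComplex

/-- The link `X_τ` of a simplex `τ` with `card τ ≤ n` (that is, of dimension at most `n - 1`),
as a weighted complex of dimension `n - card τ` with the weight `m_τ(σ) = m(τ ∪ σ)`. -/
def link {V : Type*} [Fintype V] [DecidableEq V] (X : WeightedComplex V) (τ : Finset V)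
    (hτ : IsSimplex X.complex τ) (hc : τ.card ≤ X.dim) : WeightedComplex V where
  dim := X.dim - τ.card
  complex := linkComplex X.complex τ
  pure := by
    intro s hs
    obtain ⟨hd, hs⟩ := (isSimplex_linkComplex hτ s).mp hs
    obtain ⟨t, ht, hst, htc⟩ := X.pure _ hs
    have hτt : τ ⊆ t := Finset.union_subset_left hst
    refine ⟨t \ τ, (isSimplex_linkComplex hτ _).mpr ⟨Finset.disjoint_sdiff, ?_⟩, ?_, ?_⟩
    · rwa [Finset.union_sdiff_of_subset hτt]
    · exact Finset.subset_sdiff.mpr ⟨Finset.union_subset_right hst, hd.symm⟩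
    · rw [Finset.card_sdiff_of_subset hτt]
      omega
  weight := fun σ => X.weight (τ ∪ σ)
  weight_pos := fun s hs => X.weight_pos _ ((isSimplex_linkComplex hτ s).mp hs).2
  weight_balanced := by
    intro η hη hηc
    obtain ⟨hd, hη'⟩ := (isSimplex_linkComplex hτ η).mp hη
    have hcard : (τ ∪ η).card = τ.card + η.card := Finset.card_union_of_disjoint hd
    rw [← X.weight_balanced (τ ∪ η) hη' (by omega)]
    refine finsum_mem_eq_of_bijOn (fun σ => τ ∪ σ) ⟨?_, ?_, ?_⟩ (fun _ _ => rfl)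
    · rintro σ ⟨hσ, hησ, hσc⟩
      obtain ⟨hdσ, hσ'⟩ := (isSimplex_linkComplex hτ σ).mp hσ
      refine ⟨hσ', Finset.union_subset_union_right hησ, ?_⟩
      rw [Finset.card_union_of_disjoint hdσ]
      omega
    · rintro σ ⟨hσ, -, -⟩ ρ ⟨hρ, -, -⟩ h
      have h1 := ((isSimplex_linkComplex hτ σ).mp hσ).1
      have h2 := ((isSimplex_linkComplex hτ ρ).mp hρ).1
      have h3 : τ ∪ σ = τ ∪ ρ := h
      rw [← Finset.union_sdiff_cancel_left h1, h3, Finset.union_sdiff_cancel_left h2]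
    · rintro γ ⟨hγ, hsub, hγc⟩
      have hτγ : τ ⊆ γ := Finset.union_subset_left hsub
      have hu : τ ∪ γ \ τ = γ := Finset.union_sdiff_of_subset hτγ
      refine ⟨γ \ τ, ⟨(isSimplex_linkComplex hτ _).mpr ⟨Finset.disjoint_sdiff, by rwa [hu]⟩,
        Finset.subset_sdiff.mpr ⟨Finset.union_subset_right hsub, hd.symm⟩, ?_⟩, hu⟩
      rw [Finset.card_sdiff_of_subset hτγ]
      omega

/-- All links of positive dimension are connected, including `X` itself as the link of `∅`. -/
def LinksConnected {V : Type*} [Fintype V] [DecidableEq V] (X : WeightedComplex V) : Prop :=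
  ∀ τ, IsSimplex X.complex τ → τ.card < X.dim → IsConnectedComplex (linkComplex X.complex τ)

/-- The space `C^{j-1}(X, ℝ)` of forms on ordered simplices with `j` vertices. -/
def Cochain {V : Type*} [Fintype V] (X : WeightedComplex V) (j : ℕ) : Type _ :=
  antisymmetricForms X.complex j

section Cochains

variable {V : Type*} [Fintype V] (X : WeightedComplex V)

instance (j : ℕ) : AddCommGroup (X.Cochain j) :=
  inferInstanceAs (AddCommGroup (antisymmetricForms X.complex j))

instance (j : ℕ) : Module ℝ (X.Cochain j) :=
  inferInstanceAs (Module ℝ (antisymmetricForms X.complex j))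

/-- The inner product `⟪φ, ψ⟫ = ∑_τ m(τ) / j! · φ(τ) ψ(τ)` over ordered simplices `τ` with `j`
vertices. -/
@[reducible] noncomputable def innerCore (j : ℕ) : InnerProductSpace.Core ℝ (X.Cochain j) where
  inner φ ψ := ∑ τ : OrdSimplex X.complex j,
    X.weight τ.support / (j.factorial : ℝ) * φ.1 τ * ψ.1 τ
  conj_inner_symm φ ψ := by
    simp only [conj_trivial]
    exact Finset.sum_congr rfl fun τ _ => by ring
  re_inner_nonneg φ := by
    simp only [RCLike.re_to_real]
    refine Finset.sum_nonneg fun τ _ => ?_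
    have h := (X.weight_pos _ τ.2).le
    rw [mul_assoc]
    exact mul_nonneg (div_nonneg h (Nat.cast_nonneg _)) (mul_self_nonneg _)
  add_left φ ψ χ := by
    rw [← Finset.sum_add_distrib]
    refine Finset.sum_congr rfl fun τ _ => ?_
    have h : (φ + ψ).1 τ = φ.1 τ + ψ.1 τ := rfl
    rw [h]
    ring
  smul_left φ ψ r := by
    simp only [conj_trivial]
    rw [Finset.mul_sum]
    refine Finset.sum_congr rfl fun τ _ => ?_
    have h : (r • φ).1 τ = r * φ.1 τ := rfl
    rw [h]
    ring
  definite φ h := by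
    apply Subtype.ext
    funext τ
    have hpos : ∀ τ : OrdSimplex X.complex j, 0 < X.weight τ.support / (j.factorial : ℝ) :=
      fun τ => div_pos (X.weight_pos _ τ.2) (by positivity)
    have h0 := (Finset.sum_eq_zero_iff_of_nonneg (fun τ _ => by
      rw [mul_assoc]
      exact mul_nonneg (hpos τ).le (mul_self_nonneg _))).mp h τ (Finset.mem_univ _)
    rw [mul_assoc] at h0
    exact mul_self_eq_zero.mp ((mul_eq_zero.mp h0).resolve_left (hpos τ).ne')

noncomputable instance (j : ℕ) : NormedAddCommGroup (X.Cochain j) :=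
  (X.innerCore j).toNormedAddCommGroup

noncomputable instance (j : ℕ) : InnerProductSpace ℝ (X.Cochain j) :=
  InnerProductSpace.ofCore (X.innerCore j).toCore

instance (j : ℕ) : FiniteDimensional ℝ (X.Cochain j) :=
  inferInstanceAs (FiniteDimensional ℝ (antisymmetricForms X.complex j))

theorem inner_def (j : ℕ) (φ ψ : X.Cochain j) :
    inner ℝ φ ψ = ∑ τ : OrdSimplex X.complex j,
      X.weight τ.support / (j.factorial : ℝ) * φ.1 τ * ψ.1 τ := rfl

/-- The differential `d_{j-1} : C^{j-1}(X, ℝ) → C^j(X, ℝ)`; the source consists of forms on `j`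
vertices, so `d 0` maps constants (forms on `∅`) to `0`-forms. -/
def d (j : ℕ) : X.Cochain j →ₗ[ℝ] X.Cochain (j + 1) :=
  formDifferential X.complex j

theorem d_comp_d (j : ℕ) : X.d (j + 1) ∘ₗ X.d j = 0 :=
  formDifferential_comp X.complex j

/-- The codifferential `δ_{j-1}`, the adjoint of `d_{j-1}`. -/
noncomputable def codifferential (j : ℕ) : X.Cochain (j + 1) →ₗ[ℝ] X.Cochain j :=
  LinearMap.adjoint (X.d j)

/-- The upper Laplacian `Δ_k^+ = δ_k d_k` on the space `C^k(X, ℝ)` of `k`-forms. -/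
noncomputable def upperLaplacian (k : ℕ) : Module.End ℝ (X.Cochain (k + 1)) :=
  X.codifferential (k + 1) ∘ₗ X.d (k + 1)

/-- The lower Laplacian `Δ_k^- = d_{k-1} δ_{k-1}` on the space `C^k(X, ℝ)` of `k`-forms. -/
noncomputable def lowerLaplacian (k : ℕ) : Module.End ℝ (X.Cochain (k + 1)) :=
  X.d k ∘ₗ X.codifferential k

/-- The reduced cohomology `H̃^k(X, ℝ) = ker d_k / im d_{k-1}`, `k ≥ 0`, where for `k = 0` the map
`d_{-1}` sends a real number to the constant `0`-form. -/
abbrev ReducedCohomology (k : ℕ) : Type _ :=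
  LinearMap.ker (X.d (k + 1)) ⧸
    (LinearMap.range (X.d k)).submoduleOf (LinearMap.ker (X.d (k + 1)))

end Cochains

/-- `Spec(Δ_{τ,0}^+) ∖ {0} ⊆ S` for every `1`-dimensional link `X_τ`, i.e. for every simplex `τ` of
dimension `n - 2` (only `τ = ∅`, with `X_∅ = X`, if `n = 1`). -/
def OneDimLinksSpectrumIn {V : Type*} [Fintype V] [DecidableEq V] (X : WeightedComplex V)
    (S : Set ℝ) : Prop :=
  ∀ (τ : Finset V) (hτ : IsSimplex X.complex τ) (hc : τ.card + 1 = X.dim),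
    spectrum ℝ ((X.link τ hτ (by omega)).upperLaplacian 0) \ {0} ⊆ S

end WeightedComplex

/-- `(k + 1) f^{n-1-k}(x) - k`, where `f(x) = 2 - 1/x` and `f^j` is the `j`-fold iterate. -/
noncomputable def spectralBound (n k : ℕ) (x : ℝ) : ℝ :=
  ((k : ℝ) + 1) * (fun y : ℝ => 2 - 1 / y)^[n - 1 - k] x - k

/-!
The proof is Garland's method combined with descent of spectral gaps from links of smaller
dimension.

*Localization* (`inner_d_self`, `inner_d_self_of_links`). For a `k`-form `φ` and an ordered simplex
`t` with `k` vertices, `v ↦ φ(v, t)` is a function on the vertices of the link of `t`. Summing over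
`t` expresses `‖φ‖²` by the norms and `‖dφ‖²` by the norms and energies of these functions, and
`δφ(t)` is their mean. Hence if `δφ = 0`, and all these links have their spectral gap in `[l, u]`,
then `‖dφ‖²` lies between `((k + 1) l - k) ‖φ‖²` and `((k + 1) u - k) ‖φ‖²`.

*Descent* (`spectrum_subset_of_vertex_links`). For an eigenfunction of `Δ₀⁺` with eigenvalue
`α ≠ 0`, restricting to the links of the vertices and summing gives `l α (2 - α) ≤ α ≤ u α (2 - α)`,
where `[l, u]` contains the gaps of these links; so `α` lies in `[2 - 1 / l, 2 - 1 / u]`. Links of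
links are links (`link_link`), so by induction on the dimension (`hasGap_of_oneDimLinks`) the gaps
of the one-dimensional links descend to every link of positive dimension. Connectedness enters
through `hasGap_of_spectrum`: it makes the kernel of `Δ₀⁺` the constants, so that a bound on the
nonzero spectrum is a bound for all functions of mean zero.

The assumption `lam > (n - 1) / n` makes the resulting bound positive, so no nonzero form is both
closed and coclosed; `ker d = im d` and the remaining claims follow by finite-dimensional Hodge
theory.

All sums are taken over arbitrary tuples of vertices, with weights and forms extended by zero
(`tupleWeight`, `eval`), so that adding a vertex to a simplex is `Matrix.vecCons`.
-/

/-! ### Sums over tuples -/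

/-- Summing over tuples one entry longer is summing over the tail and over the first entry. -/
theorem sum_vecCons {V : Type*} [Fintype V] {j : ℕ} (F : (Fin (j + 1) → V) → ℝ) :
    ∑ t, F t = ∑ t : Fin j → V, ∑ v : V, F (Matrix.vecCons v t) := by
  rw [Finset.sum_comm, ← Fintype.sum_prod_type']
  exact (Equiv.sum_comp (Fin.consEquiv fun _ => V) F).symm

/-- Against an antisymmetric function `ψ` and a symmetric weight `w`, all `j + 1` terms of the
alternating sum over faces contribute the same: a cyclic permutation moves the omitted entry to the
front, at the cost of the sign `(-1)^i`. -/
theorem sum_alternating_faces {V : Type*} [Fintype V] {j : ℕ} (w ψ : (Fin (j + 1) → V) → ℝ)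
    (g : (Fin j → V) → ℝ) (hw : ∀ (π : Equiv.Perm (Fin (j + 1))) t, w (t ∘ π) = w t)
    (hψ : ∀ (π : Equiv.Perm (Fin (j + 1))) t,
      ψ (t ∘ π) = ((Equiv.Perm.sign π : ℤ) : ℝ) * ψ t) :
    ∑ t, w t * ψ t * ∑ i : Fin (j + 1), (-1 : ℝ) ^ (i : ℕ) * g (t ∘ i.succAbove)
      = ((j : ℝ) + 1) * ∑ t : Fin j → V, ∑ v : V,
          w (Matrix.vecCons v t) * ψ (Matrix.vecCons v t) * g t := by
  have key : ∀ i : Fin (j + 1), ∑ t, w t * ψ t * ((-1 : ℝ) ^ (i : ℕ) * g (t ∘ i.succAbove))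
      = ∑ t, w t * ψ t * g (t ∘ Fin.succ) := by
    intro i
    rw [← Equiv.sum_comp (Equiv.arrowCongr i.cycleRange (Equiv.refl V))
      (fun t => w t * ψ t * g (t ∘ Fin.succ))]
    refine Finset.sum_congr rfl fun t _ => ?_
    have h1 : (Equiv.arrowCongr i.cycleRange (Equiv.refl V)) t = t ∘ i.cycleRange.symm := rfl
    have h2 : (t ∘ i.cycleRange.symm) ∘ Fin.succ = t ∘ i.succAbove := by
      funext k
      simp
    rw [h1, h2, hw, hψ, Equiv.Perm.sign_symm, Fin.sign_cycleRange]
    push_cast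
    ring
  simp only [Finset.mul_sum]
  rw [Finset.sum_comm]
  simp only [key, Finset.sum_const, Finset.card_univ, Fintype.card_fin, nsmul_eq_mul]
  rw [sum_vecCons]
  simp only [← Finset.mul_sum]
  push_cast
  rfl

theorem vecCons_comp_decomposeFin {V : Type*} {j : ℕ} (π : Equiv.Perm (Fin j)) (v : V)
    (t : Fin j → V) :
    Matrix.vecCons v (t ∘ π) = Matrix.vecCons v t ∘ Equiv.Perm.decomposeFin.symm (0, π) := by
  funext i
  refine Fin.cases ?_ (fun k => ?_) i
  · simp
  · simp

theorem image_comp_perm {V : Type*} [DecidableEq V] {j : ℕ} (π : Equiv.Perm (Fin j))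
    (t : Fin j → V) :
    Finset.univ.image (t ∘ π) = Finset.univ.image t := by
  rw [← Finset.image_image, Finset.image_univ_equiv]

theorem image_vecCons {V : Type*} [DecidableEq V] {j : ℕ} (v : V) (t : Fin j → V) :
    Finset.univ.image (Matrix.vecCons v t) = insert v (Finset.univ.image t) := by
  ext x
  simp [Fin.exists_fin_succ, eq_comm]

namespace WeightedComplex

variable {V : Type*} [Fintype V] [DecidableEq V] (X : WeightedComplex V)

/-! ### Extension by zero to all tuples -/

/-- The tuple `t` is an ordered simplex: its entries are distinct and span a simplex. -/
def IsOrdered {j : ℕ} (t : Fin j → V) : Prop :=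
  Function.Injective t ∧ IsSimplex X.complex (Finset.univ.image t)

open Classical in
/-- The weight of the simplex spanned by a tuple, extended by zero to the tuples that are not
ordered simplices. -/
noncomputable def tupleWeight {j : ℕ} (t : Fin j → V) : ℝ :=
  if X.IsOrdered t then X.weight (Finset.univ.image t) else 0

open Classical in
/-- The value of a form on a tuple, extended by zero to the tuples that are not ordered
simplices. -/
noncomputable def eval {j : ℕ} (φ : X.Cochain j) (t : Fin j → V) : ℝ :=
  if h : X.IsOrdered t then φ.1 ⟨⟨t, h.1⟩, by rw [Finset.map_eq_image]; exact h.2⟩ else 0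

variable {X}

theorem isOrdered_coe {j : ℕ} (v : OrdSimplex X.complex j) : X.IsOrdered v.1 :=
  ⟨v.1.injective, by have := v.2; rwa [Finset.map_eq_image] at this⟩

theorem tupleWeight_coe {j : ℕ} (v : OrdSimplex X.complex j) :
    X.tupleWeight v.1 = X.weight v.support := by
  rw [tupleWeight, if_pos (isOrdered_coe v), OrdSimplex.support, Finset.map_eq_image]

theorem eval_coe {j : ℕ} (φ : X.Cochain j) (v : OrdSimplex X.complex j) :
    X.eval φ v.1 = φ.1 v := by
  rw [eval, dif_pos (isOrdered_coe v)]
  rfl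

theorem IsOrdered.exists_coe {j : ℕ} {t : Fin j → V} (h : X.IsOrdered t) :
    ∃ v : OrdSimplex X.complex j, (v.1 : Fin j → V) = t :=
  ⟨⟨⟨t, h.1⟩, by rw [Finset.map_eq_image]; exact h.2⟩, rfl⟩

theorem tupleWeight_pos {j : ℕ} {t : Fin j → V} (h : X.IsOrdered t) : 0 < X.tupleWeight t := by
  rw [tupleWeight, if_pos h]
  exact X.weight_pos _ h.2

theorem tupleWeight_of_not {j : ℕ} {t : Fin j → V} (h : ¬ X.IsOrdered t) : X.tupleWeight t = 0 :=
  if_neg h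

theorem eval_of_not {j : ℕ} (φ : X.Cochain j) {t : Fin j → V} (h : ¬ X.IsOrdered t) :
    X.eval φ t = 0 :=
  dif_neg h

theorem isOrdered_comp_perm {j : ℕ} (π : Equiv.Perm (Fin j)) (t : Fin j → V) :
    X.IsOrdered (t ∘ π) ↔ X.IsOrdered t := by
  rw [IsOrdered, IsOrdered, image_comp_perm, π.injective_comp]

theorem tupleWeight_comp_perm {j : ℕ} (π : Equiv.Perm (Fin j)) (t : Fin j → V) :
    X.tupleWeight (t ∘ π) = X.tupleWeight t := by
  by_cases h : X.IsOrdered t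
  · rw [tupleWeight, tupleWeight, if_pos h, if_pos ((isOrdered_comp_perm π t).mpr h),
      image_comp_perm]
  · rw [tupleWeight_of_not h, tupleWeight_of_not (by rwa [isOrdered_comp_perm])]

theorem tupleWeight_vecCons_comm {j : ℕ} (u v : V) (t : Fin j → V) :
    X.tupleWeight (Matrix.vecCons v (Matrix.vecCons u t))
      = X.tupleWeight (Matrix.vecCons u (Matrix.vecCons v t)) := by
  have hsw : Matrix.vecCons v (Matrix.vecCons u t)
      = Matrix.vecCons u (Matrix.vecCons v t) ∘ Equiv.swap 0 1 := by
    funext i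
    refine Fin.cases ?_ (fun m => Fin.cases ?_ (fun l => ?_) m) i
    · simp
    · rw [Fin.succ_zero_eq_one]
      simp
    · have : Equiv.swap (0 : Fin (j + 2)) 1 l.succ.succ = l.succ.succ :=
        Equiv.swap_apply_of_ne_of_ne (Fin.succ_ne_zero _) (by
          rw [← Fin.succ_zero_eq_one]
          exact fun h => Fin.succ_ne_zero _ (Fin.succ_injective _ h))
      simp [this]
  rw [hsw, tupleWeight_comp_perm]

theorem eval_comp_perm {j : ℕ} (φ : X.Cochain j) (π : Equiv.Perm (Fin j)) (t : Fin j → V) :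
    X.eval φ (t ∘ π) = ((Equiv.Perm.sign π : ℤ) : ℝ) * X.eval φ t := by
  by_cases h : X.IsOrdered t
  · obtain ⟨v, rfl⟩ := h.exists_coe
    rw [eval_coe, ← φ.2 π v, ← eval_coe φ (v.comp π.toEmbedding)]
    rfl
  · rw [eval_of_not _ h, eval_of_not _ (by rwa [isOrdered_comp_perm]), mul_zero]

theorem isOrdered_vecCons {j : ℕ} (v : V) (t : Fin j → V) :
    X.IsOrdered (Matrix.vecCons v t) ↔ v ∉ Finset.univ.image t ∧ Function.Injective t ∧
      IsSimplex X.complex (insert v (Finset.univ.image t)) := by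
  rw [IsOrdered, image_vecCons, Matrix.vecCons, Fin.cons_injective_iff, and_assoc]
  simp

theorem IsOrdered.of_vecCons {j : ℕ} {v : V} {t : Fin j → V}
    (h : X.IsOrdered (Matrix.vecCons v t)) : X.IsOrdered t :=
  have h' := (isOrdered_vecCons v t).mp h
  ⟨h'.2.1, h'.2.2.subset (Finset.subset_insert _ _)⟩

theorem card_image_of_isOrdered {j : ℕ} {t : Fin j → V} (h : X.IsOrdered t) :
    (Finset.univ.image t).card = j := by
  rw [Finset.card_image_of_injective _ h.1, Finset.card_univ, Fintype.card_fin]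

/-- The balance condition on the weight, for tuples. -/
theorem sum_tupleWeight_vecCons {j : ℕ} (hj : j ≤ X.dim) (t : Fin j → V) :
    ∑ v, X.tupleWeight (Matrix.vecCons v t) = X.tupleWeight t := by
  by_cases h : X.IsOrdered t
  · have hcard := card_image_of_isOrdered h
    conv_rhs => rw [tupleWeight, if_pos h, ← X.weight_balanced _ h.2 (by omega)]
    classical
    have h0 : ∑ v, X.tupleWeight (Matrix.vecCons v t)
        = ∑ v ∈ Finset.univ.filter (fun v => X.IsOrdered (Matrix.vecCons v t)),
            X.tupleWeight (Matrix.vecCons v t) := by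
      rw [Finset.sum_filter]
      refine Finset.sum_congr rfl fun v _ => ?_
      split_ifs with hv
      · rfl
      · exact tupleWeight_of_not hv
    rw [h0, ← finsum_mem_finset_eq_sum]
    refine finsum_mem_eq_of_bijOn (fun v => insert v (Finset.univ.image t)) ⟨?_, ?_, ?_⟩ ?_
    · intro v hv
      have hv' := (isOrdered_vecCons v t).mp (by simpa using hv)
      exact ⟨hv'.2.2, Finset.subset_insert _ _, Finset.card_insert_of_notMem hv'.1⟩
    · intro v hv u hu huv
      have hv' := (isOrdered_vecCons v t).mp (by simpa using hv)
      have : v ∈ insert u (Finset.univ.image t) := by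
        rw [← show insert v (Finset.univ.image t) = insert u (Finset.univ.image t) from huv]
        exact Finset.mem_insert_self _ _
      exact (Finset.mem_insert.mp this).resolve_right hv'.1
    · rintro σ ⟨hσ, hsub, hσc⟩
      obtain ⟨v, hv, rfl⟩ := Finset.exists_eq_insert_iff.mpr ⟨hsub, hσc.symm⟩
      refine ⟨v, ?_, rfl⟩
      simpa using (isOrdered_vecCons v t).mpr ⟨hv, h.1, hσ⟩
    · intro v hv
      rw [tupleWeight, if_pos (by simpa using hv), image_vecCons]
  · rw [tupleWeight_of_not h]
    exact Finset.sum_eq_zero fun v _ => tupleWeight_of_not fun hv => h hv.of_vecCons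

theorem inner_eq_sum_tuples {j : ℕ} (φ ψ : X.Cochain j) :
    (j.factorial : ℝ) * inner ℝ φ ψ = ∑ t, X.tupleWeight t * X.eval φ t * X.eval ψ t := by
  rw [inner_def, Finset.mul_sum]
  refine Fintype.sum_of_injective (fun v : OrdSimplex X.complex j => (v.1 : Fin j → V))
    (fun u v h => Subtype.ext (DFunLike.coe_injective h)) _ _ ?_ ?_
  · intro t ht
    rw [tupleWeight_of_not, zero_mul, zero_mul]
    exact fun h => ht h.exists_coe
  · intro v
    have : (j.factorial : ℝ) ≠ 0 := by positivity
    simp only [eval_coe, tupleWeight_coe]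
    field_simp

theorem eval_d {j : ℕ} (φ : X.Cochain j) {t : Fin (j + 1) → V} (h : X.IsOrdered t) :
    X.eval (X.d j φ) t
      = ∑ i : Fin (j + 1), (-1 : ℝ) ^ (i : ℕ) * X.eval φ (t ∘ i.succAbove) := by
  obtain ⟨v, rfl⟩ := h.exists_coe
  rw [eval_coe]
  change ∑ i : Fin (j + 1), (-1 : ℝ) ^ (i : ℕ) * φ.1 (v.face i) = _
  refine Finset.sum_congr rfl fun i _ => ?_
  rw [← eval_coe]
  rfl

/-- The form with the values of an antisymmetric function of tuples. -/
def ofTuples {j : ℕ} (F : (Fin j → V) → ℝ)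
    (hF : ∀ (π : Equiv.Perm (Fin j)) t, F (t ∘ π) = ((Equiv.Perm.sign π : ℤ) : ℝ) * F t) :
    X.Cochain j :=
  ⟨fun v => F v.1, fun π v => hF π v.1⟩

theorem eval_ofTuples {j : ℕ} (F : (Fin j → V) → ℝ)
    (hF : ∀ (π : Equiv.Perm (Fin j)) t, F (t ∘ π) = ((Equiv.Perm.sign π : ℤ) : ℝ) * F t)
    {t : Fin j → V} (h : X.IsOrdered t) : X.eval (ofTuples (X := X) F hF) t = F t := by
  obtain ⟨v, rfl⟩ := h.exists_coe
  rw [eval_coe]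
  rfl

theorem eval_smul {j : ℕ} (c : ℝ) (φ : X.Cochain j) (t : Fin j → V) :
    X.eval (c • φ) t = c * X.eval φ t := by
  by_cases h : X.IsOrdered t
  · obtain ⟨v, rfl⟩ := h.exists_coe
    simp only [eval_coe]
    rfl
  · simp [eval_of_not _ h]

/-! ### The codifferential and the energy of a form -/

/-- Pairing with `dφ`: by antisymmetry, only the face omitting the first vertex has to be kept. -/
theorem inner_d {j : ℕ} (φ : X.Cochain j) (ψ : X.Cochain (j + 1)) :
    (j.factorial : ℝ) * inner ℝ (X.d j φ) ψ = ∑ t : Fin j → V, ∑ v : V,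
      X.tupleWeight (Matrix.vecCons v t) * X.eval ψ (Matrix.vecCons v t) * X.eval φ t := by
  have h1 := inner_eq_sum_tuples (X.d j φ) ψ
  have h2 := sum_alternating_faces X.tupleWeight (X.eval ψ) (X.eval φ)
    tupleWeight_comp_perm (eval_comp_perm ψ)
  have h3 : ∑ t, X.tupleWeight t * X.eval (X.d j φ) t * X.eval ψ t
      = ∑ t, X.tupleWeight t * X.eval ψ t *
          ∑ i : Fin (j + 1), (-1 : ℝ) ^ (i : ℕ) * X.eval φ (t ∘ i.succAbove) := by
    refine Finset.sum_congr rfl fun t _ => ?_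
    by_cases h : X.IsOrdered t
    · rw [eval_d _ h]
      ring
    · simp [tupleWeight_of_not h]
  rw [h3, h2, Nat.factorial_succ] at h1
  push_cast at h1
  have h4 : ((j : ℝ) + 1) ≠ 0 := by positivity
  rw [mul_assoc] at h1
  exact mul_left_cancel₀ h4 h1

/-- The codifferential averages over the vertices that extend a simplex. -/
theorem tupleWeight_mul_eval_codifferential {j : ℕ} (φ : X.Cochain (j + 1)) (t : Fin j → V) :
    X.tupleWeight t * X.eval (X.codifferential j φ) t
      = ∑ v, X.tupleWeight (Matrix.vecCons v t) * X.eval φ (Matrix.vecCons v t) := by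
  set F : (Fin j → V) → ℝ := fun t => (X.tupleWeight t)⁻¹ *
    ∑ v, X.tupleWeight (Matrix.vecCons v t) * X.eval φ (Matrix.vecCons v t) with hFdef
  have hF : ∀ (π : Equiv.Perm (Fin j)) t, F (t ∘ π) = ((Equiv.Perm.sign π : ℤ) : ℝ) * F t := by
    intro π t
    simp only [hFdef, tupleWeight_comp_perm, vecCons_comp_decomposeFin, eval_comp_perm,
      Equiv.Perm.decomposeFin.symm_sign, if_true, one_mul]
    simp only [Finset.mul_sum]
    exact Finset.sum_congr rfl fun v _ => by ring
  have hmul : ∀ t, X.tupleWeight t * X.eval (ofTuples (X := X) F hF) t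
      = ∑ v, X.tupleWeight (Matrix.vecCons v t) * X.eval φ (Matrix.vecCons v t) := by
    intro t
    by_cases h : X.IsOrdered t
    · rw [eval_ofTuples F hF h]
      exact mul_inv_cancel_left₀ (tupleWeight_pos h).ne' _
    · rw [tupleWeight_of_not h, zero_mul]
      refine (Finset.sum_eq_zero fun v _ => ?_).symm
      rw [tupleWeight_of_not fun hv => h hv.of_vecCons, zero_mul]
  have heq : X.codifferential j φ = ofTuples (X := X) F hF := by
    refine ext_inner_right ℝ fun ψ => ?_
    rw [codifferential, LinearMap.adjoint_inner_left, real_inner_comm]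
    have h0 : (j.factorial : ℝ) ≠ 0 := by positivity
    apply mul_left_cancel₀ h0
    rw [inner_d, inner_eq_sum_tuples]
    refine Finset.sum_congr rfl fun t _ => ?_
    rw [hmul, Finset.sum_mul]
  rw [heq, hmul]

theorem eval_d_vecCons {k : ℕ} (φ : X.Cochain (k + 1)) (v : V) (s : Fin (k + 1) → V)
    (h : X.IsOrdered (Matrix.vecCons v s)) :
    X.eval (X.d (k + 1) φ) (Matrix.vecCons v s) = X.eval φ s -
      ∑ i : Fin (k + 1), (-1 : ℝ) ^ (i : ℕ) *
        X.eval φ (Matrix.vecCons v (s ∘ i.succAbove)) := by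
  rw [eval_d _ h, Fin.sum_univ_succ, sub_eq_add_neg, ← Finset.sum_neg_distrib]
  congr 1
  · simp only [Fin.val_zero, pow_zero, one_mul]
    congr 1
  · refine Finset.sum_congr rfl fun i _ => ?_
    have : Matrix.vecCons v s ∘ (i.succ).succAbove = Matrix.vecCons v (s ∘ i.succAbove) := by
      funext l
      refine Fin.cases ?_ (fun m => ?_) l
      · simp
      · simp
    rw [this, Fin.val_succ, pow_succ]
    ring

/-- Garland's localization of the energy `‖dφ‖²`: off the diagonal only the values of `φ` on pairs
of faces sharing all vertices but one interact. -/
theorem inner_d_self {k : ℕ} (hk : k + 1 ≤ X.dim) (φ : X.Cochain (k + 1)) :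
    (k.factorial : ℝ) * inner ℝ (X.d (k + 1) φ) (X.d (k + 1) φ)
      = k.factorial * inner ℝ φ φ - ∑ t : Fin k → V, ∑ v, ∑ u,
        X.tupleWeight (Matrix.vecCons u (Matrix.vecCons v t)) *
          X.eval φ (Matrix.vecCons u t) * X.eval φ (Matrix.vecCons v t) := by
  have hk1 : ((k : ℝ) + 1) ≠ 0 := by positivity
  apply mul_left_cancel₀ hk1
  have h1 := inner_d φ (X.d (k + 1) φ)
  rw [Nat.factorial_succ] at h1
  push_cast at h1
  have h2 := inner_eq_sum_tuples φ φ
  rw [Nat.factorial_succ] at h2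
  push_cast at h2
  rw [mul_sub, ← mul_assoc, ← mul_assoc, h1, h2, Finset.sum_comm]
  have h3 : ∀ v : V, ∑ s : Fin (k + 1) → V, X.tupleWeight (Matrix.vecCons v s) *
      X.eval (X.d (k + 1) φ) (Matrix.vecCons v s) * X.eval φ s
      = ∑ s : Fin (k + 1) → V, X.tupleWeight (Matrix.vecCons v s) * X.eval φ s * X.eval φ s
        - ∑ s : Fin (k + 1) → V, X.tupleWeight (Matrix.vecCons v s) * X.eval φ s *
          ∑ i : Fin (k + 1), (-1 : ℝ) ^ (i : ℕ) *
            X.eval φ (Matrix.vecCons v (s ∘ i.succAbove)) := by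
    intro v
    rw [← Finset.sum_sub_distrib]
    refine Finset.sum_congr rfl fun s _ => ?_
    by_cases h : X.IsOrdered (Matrix.vecCons v s)
    · rw [eval_d_vecCons φ v s h]
      ring
    · simp [tupleWeight_of_not h]
  -- For fixed `v`, the faces of `(v, s)` containing `v` again form an alternating sum over faces
  -- of `s`, paired with the antisymmetric function `φ`.
  have h4 : ∀ v : V, ∑ s : Fin (k + 1) → V, X.tupleWeight (Matrix.vecCons v s) * X.eval φ s *
          ∑ i : Fin (k + 1), (-1 : ℝ) ^ (i : ℕ) *
            X.eval φ (Matrix.vecCons v (s ∘ i.succAbove))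
      = ((k : ℝ) + 1) * ∑ t : Fin k → V, ∑ u,
        X.tupleWeight (Matrix.vecCons v (Matrix.vecCons u t)) *
          X.eval φ (Matrix.vecCons u t) * X.eval φ (Matrix.vecCons v t) := by
    intro v
    refine sum_alternating_faces (fun s => X.tupleWeight (Matrix.vecCons v s)) (X.eval φ)
      (fun t => X.eval φ (Matrix.vecCons v t)) (fun π t => ?_) (eval_comp_perm φ)
    rw [vecCons_comp_decomposeFin, tupleWeight_comp_perm]
  simp only [h3, h4, Finset.sum_sub_distrib, ← Finset.mul_sum]
  congr 1
  · rw [Finset.sum_comm]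
    refine Finset.sum_congr rfl fun s _ => ?_
    rw [← sum_tupleWeight_vecCons hk s, Finset.sum_mul, Finset.sum_mul]
  · congr 1
    rw [Finset.sum_comm]
    refine Finset.sum_congr rfl fun t _ => ?_
    rw [Finset.sum_comm]
    refine Finset.sum_congr rfl fun u _ => Finset.sum_congr rfl fun v _ => ?_
    rw [tupleWeight_vecCons_comm]
    ring

end WeightedComplex

/-! ### Rayleigh quotients -/

/-- If the nonzero spectrum of a symmetric operator lies in `[l, u]`, so do its Rayleigh quotients
at vectors orthogonal to the kernel. -/
theorem LinearMap.IsSymmetric.rayleigh_mem_Icc {E : Type*} [NormedAddCommGroup E]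
    [InnerProductSpace ℝ E] [FiniteDimensional ℝ E] {T : Module.End ℝ E} (hT : T.IsSymmetric)
    {l u : ℝ} (h : spectrum ℝ T \ {0} ⊆ Set.Icc l u) {x : E}
    (hx : ∀ z, T z = 0 → inner ℝ z x = 0) :
    l * inner ℝ x x ≤ inner ℝ (T x) x ∧ inner ℝ (T x) x ≤ u * inner ℝ x x := by
  set b := hT.eigenvectorBasis rfl with hb
  have h1 : inner ℝ x x = ∑ i, inner ℝ (b i) x * inner ℝ (b i) x := by
    rw [← b.sum_inner_mul_inner]
    exact Finset.sum_congr rfl fun i _ => by rw [real_inner_comm]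
  have h2 : inner ℝ (T x) x
      = ∑ i, hT.eigenvalues rfl i * (inner ℝ (b i) x * inner ℝ (b i) x) := by
    rw [← b.sum_inner_mul_inner]
    refine Finset.sum_congr rfl fun i _ => ?_
    rw [hT x (b i), hb, hT.apply_eigenvectorBasis, real_inner_smul_right, real_inner_comm]
    simp only [RCLike.ofReal_real_eq_id, id_eq]
    ring
  have h3 : ∀ i, inner ℝ (b i) x = 0 ∨ hT.eigenvalues rfl i ∈ Set.Icc l u := by
    intro i
    by_cases h0 : hT.eigenvalues rfl i = 0
    · left
      apply hx
      rw [hb, hT.apply_eigenvectorBasis, h0]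
      simp
    · right
      refine h ⟨?_, h0⟩
      rw [← Module.End.hasEigenvalue_iff_mem_spectrum]
      exact hT.hasEigenvalue_eigenvalues rfl i
  rw [h1, h2, Finset.mul_sum, Finset.mul_sum]
  constructor
  · refine Finset.sum_le_sum fun i _ => ?_
    rcases h3 i with h | h
    · simp [h]
    · exact mul_le_mul_of_nonneg_right h.1 (mul_self_nonneg _)
  · refine Finset.sum_le_sum fun i _ => ?_
    rcases h3 i with h | h
    · simp [h]
    · exact mul_le_mul_of_nonneg_right h.2 (mul_self_nonneg _)

namespace WeightedComplex

variable {V : Type*} [Fintype V] {X : WeightedComplex V}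

theorem eq_of_fields {X Y : WeightedComplex V} (h1 : X.dim = Y.dim) (h2 : X.complex = Y.complex)
    (h3 : X.weight = Y.weight) : X = Y := by
  cases X
  cases Y
  cases h1
  cases h2
  cases h3
  rfl

/-! ### The Laplacians as quadratic forms -/

theorem inner_upperLaplacian (k : ℕ) (φ ψ : X.Cochain (k + 1)) :
    inner ℝ (X.upperLaplacian k φ) ψ = inner ℝ (X.d (k + 1) φ) (X.d (k + 1) ψ) := by
  rw [upperLaplacian, LinearMap.comp_apply, codifferential, LinearMap.adjoint_inner_left]

theorem inner_lowerLaplacian (k : ℕ) (φ ψ : X.Cochain (k + 1)) :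
    inner ℝ (X.lowerLaplacian k φ) ψ
      = inner ℝ (X.codifferential k φ) (X.codifferential k ψ) := by
  rw [lowerLaplacian, LinearMap.comp_apply, codifferential, LinearMap.adjoint_inner_right]

theorem upperLaplacian_isSymmetric (k : ℕ) : (X.upperLaplacian k).IsSymmetric := by
  intro φ ψ
  rw [inner_upperLaplacian, real_inner_comm, ← inner_upperLaplacian, real_inner_comm]

theorem ker_upperLaplacian (k : ℕ) :
    LinearMap.ker (X.upperLaplacian k) = LinearMap.ker (X.d (k + 1)) := by
  ext φ
  simp only [LinearMap.mem_ker]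
  constructor
  · intro h
    rw [← inner_self_eq_zero (𝕜 := ℝ), ← inner_upperLaplacian, h, inner_zero_left]
  · intro h
    rw [upperLaplacian, LinearMap.comp_apply, h, map_zero]

theorem ker_lowerLaplacian (k : ℕ) :
    LinearMap.ker (X.lowerLaplacian k) = LinearMap.ker (X.codifferential k) := by
  ext φ
  simp only [LinearMap.mem_ker]
  constructor
  · intro h
    rw [← inner_self_eq_zero (𝕜 := ℝ), ← inner_lowerLaplacian, h, inner_zero_left]
  · intro h
    rw [lowerLaplacian, LinearMap.comp_apply, h, map_zero]

/-! ### Hodge theory -/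

/-- Every form is the sum of an exact and a coclosed form, as `ker δ` is the orthogonal complement
of `im d`. -/
theorem exists_add_codifferential_eq_zero (k : ℕ) (φ : X.Cochain (k + 1)) :
    ∃ η ψ, X.codifferential k ψ = 0 ∧ φ = X.d k η + ψ := by
  obtain ⟨y, ⟨η, rfl⟩, ψ, hψ, rfl⟩ :=
    Submodule.exists_add_mem_mem_orthogonal (K := LinearMap.range (X.d k)) φ
  refine ⟨η, ψ, ?_, rfl⟩
  rw [← inner_self_eq_zero (𝕜 := ℝ), codifferential, LinearMap.adjoint_inner_left, real_inner_comm]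
  exact hψ _ ⟨_, rfl⟩

theorem d_d (k : ℕ) (φ : X.Cochain k) : X.d (k + 1) (X.d k φ) = 0 :=
  LinearMap.congr_fun (X.d_comp_d k) φ

theorem codifferential_codifferential (k : ℕ) (φ : X.Cochain (k + 2)) :
    X.codifferential k (X.codifferential (k + 1) φ) = 0 := by
  rw [← inner_self_eq_zero (𝕜 := ℝ)]
  simp only [codifferential]
  rw [LinearMap.adjoint_inner_left, LinearMap.adjoint_inner_left, d_d, inner_zero_right]

/-- The nonzero eigenvalues of `Δ_k⁺` are attained on coclosed forms. -/
theorem spectrum_upperLaplacian_subset {k : ℕ} {a b : ℝ}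
    (h : ∀ φ : X.Cochain (k + 1), X.codifferential k φ = 0 →
      a * inner ℝ φ φ ≤ inner ℝ (X.d (k + 1) φ) (X.d (k + 1) φ) ∧
      inner ℝ (X.d (k + 1) φ) (X.d (k + 1) φ) ≤ b * inner ℝ φ φ) :
    spectrum ℝ (X.upperLaplacian k) \ {0} ⊆ Set.Icc a b := by
  rintro α ⟨hα, hα0⟩
  rw [← Module.End.hasEigenvalue_iff_mem_spectrum] at hα
  obtain ⟨φ, hφ⟩ := hα.exists_hasEigenvector
  have hφe : X.upperLaplacian k φ = α • φ := hφ.apply_eq_smul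
  have hco : X.codifferential k φ = 0 := by
    have h1 : X.codifferential k (X.upperLaplacian k φ) = 0 :=
      codifferential_codifferential k (X.d (k + 1) φ)
    rw [hφe, map_smul] at h1
    exact (smul_eq_zero.mp h1).resolve_left hα0
  have hpos : 0 < inner ℝ φ φ := real_inner_self_pos.mpr hφ.2
  have h1 := h φ hco
  rw [← inner_upperLaplacian, hφe, real_inner_smul_left] at h1
  exact ⟨le_of_mul_le_mul_right h1.1 hpos, le_of_mul_le_mul_right h1.2 hpos⟩

/-- `Δ_{k+1}⁻ = d δ` and `Δ_k⁺ = δ d` have the same nonzero spectrum; only this inclusion is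
needed. -/
theorem spectrum_lowerLaplacian_subset (k : ℕ) :
    spectrum ℝ (X.lowerLaplacian (k + 1)) \ {0} ⊆ spectrum ℝ (X.upperLaplacian k) \ {0} := by
  rintro α ⟨hα, hα0⟩
  refine ⟨?_, hα0⟩
  rw [← Module.End.hasEigenvalue_iff_mem_spectrum] at hα ⊢
  obtain ⟨φ, hφ⟩ := hα.exists_hasEigenvector
  have hφe : X.d (k + 1) (X.codifferential (k + 1) φ) = α • φ := hφ.apply_eq_smul
  refine Module.End.hasEigenvalue_of_hasEigenvector
    (x := X.codifferential (k + 1) φ) ⟨Module.End.mem_eigenspace_iff.mpr ?_, fun h0 => ?_⟩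
  · change X.codifferential (k + 1) (X.d (k + 1) (X.codifferential (k + 1) φ)) = _
    rw [hφe, map_smul]
  · rw [h0, map_zero] at hφe
    exact (smul_eq_zero.mp hφe.symm).elim hα0 hφ.2

/-- A positive lower bound for the energy of coclosed forms forces the cohomology to vanish. -/
theorem ker_d_eq_range_d {k : ℕ} {a : ℝ} (ha : 0 < a)
    (h : ∀ φ : X.Cochain (k + 1), X.codifferential k φ = 0 →
      a * inner ℝ φ φ ≤ inner ℝ (X.d (k + 1) φ) (X.d (k + 1) φ)) :
    LinearMap.ker (X.d (k + 1)) = LinearMap.range (X.d k) := by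
  apply le_antisymm
  · intro φ hφ
    obtain ⟨η, ψ, hψ, rfl⟩ := exists_add_codifferential_eq_zero k φ
    have h1 : X.d (k + 1) ψ = 0 := by
      have h2 := LinearMap.mem_ker.mp hφ
      rwa [map_add, d_d, zero_add] at h2
    have h3 := h ψ hψ
    rw [h1, inner_zero_left] at h3
    have h4 : inner ℝ ψ ψ = 0 := le_antisymm
      (nonpos_of_mul_nonpos_right h3 ha) real_inner_self_nonneg
    rw [inner_self_eq_zero.mp h4, add_zero]
    exact ⟨η, rfl⟩
  · rintro _ ⟨η, rfl⟩
    exact d_d k η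

theorem isOrtho_ker_laplacians {k : ℕ}
    (h : LinearMap.ker (X.d (k + 1)) = LinearMap.range (X.d k)) :
    LinearMap.ker (X.upperLaplacian k) ⟂ LinearMap.ker (X.lowerLaplacian k) := by
  rw [ker_upperLaplacian, ker_lowerLaplacian, h, Submodule.isOrtho_iff_inner_eq]
  rintro _ ⟨η, rfl⟩ ψ hψ
  rw [← LinearMap.adjoint_inner_right]
  change inner ℝ η (X.codifferential k ψ) = 0
  rw [LinearMap.mem_ker.mp hψ, inner_zero_right]

theorem isCompl_ker_laplacians {k : ℕ}
    (h : LinearMap.ker (X.d (k + 1)) = LinearMap.range (X.d k)) :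
    IsCompl (LinearMap.ker (X.upperLaplacian k)) (LinearMap.ker (X.lowerLaplacian k)) := by
  refine ⟨(isOrtho_ker_laplacians h).disjoint, ?_⟩
  rw [codisjoint_iff, eq_top_iff, ker_upperLaplacian, ker_lowerLaplacian, h]
  intro φ _
  obtain ⟨η, ψ, hψ, rfl⟩ := exists_add_codifferential_eq_zero k φ
  exact Submodule.add_mem_sup ⟨η, rfl⟩ hψ

variable [DecidableEq V]

/-! ### Spectral gaps of the underlying weighted graph -/

theorem sum_tuples_zero {V : Type*} [Fintype V] (F : (Fin 0 → V) → ℝ) : ∑ t, F t = F ![] := by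
  rw [Fintype.sum_unique]
  exact congrArg F (Subsingleton.elim _ _)

theorem inner_zeroForm (φ ψ : X.Cochain 1) :
    inner ℝ φ ψ = ∑ v, X.tupleWeight ![v] * (X.eval φ ![v] * X.eval ψ ![v]) := by
  have h := inner_eq_sum_tuples φ ψ
  rw [sum_vecCons, sum_tuples_zero] at h
  simpa [mul_assoc] using h

theorem inner_d_zeroForm (hX : 1 ≤ X.dim) (φ : X.Cochain 1) :
    inner ℝ (X.d 1 φ) (X.d 1 φ) = ∑ v, X.tupleWeight ![v] * (X.eval φ ![v] * X.eval φ ![v])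
      - ∑ v, ∑ u, X.tupleWeight ![u, v] * (X.eval φ ![u] * X.eval φ ![v]) := by
  have h := inner_d_self (k := 0) (by omega) φ
  rw [sum_tuples_zero, inner_zeroForm] at h
  simpa [mul_assoc] using h

variable (X) in
/-- The weighted graph underlying `X` has its spectral gap in `[l, u]`: for functions `g` of mean
zero on the vertices, the energy `‖dg‖²`, written as `‖g‖²` minus the quadratic form of the weighted
adjacency matrix, lies between `l ‖g‖²` and `u ‖g‖²`. -/
def HasGap (l u : ℝ) : Prop :=
  ∀ g : V → ℝ, ∑ v, X.tupleWeight ![v] * g v = 0 →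
    l * ∑ v, X.tupleWeight ![v] * (g v * g v) ≤ ∑ v, X.tupleWeight ![v] * (g v * g v)
        - ∑ v, ∑ u, X.tupleWeight ![u, v] * (g u * g v) ∧
    ∑ v, X.tupleWeight ![v] * (g v * g v) - ∑ v, ∑ u, X.tupleWeight ![u, v] * (g u * g v)
      ≤ u * ∑ v, X.tupleWeight ![v] * (g v * g v)

theorem isOrdered_empty : X.IsOrdered (![] : Fin 0 → V) :=
  ⟨fun i => i.elim0, Or.inl (by simp)⟩

theorem isOrdered_singleton (v : V) : X.IsOrdered ![v] ↔ IsSimplex X.complex {v} := by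
  rw [isOrdered_vecCons]
  simp [Function.injective_of_subsingleton]

theorem isOrdered_pair (u v : V) :
    X.IsOrdered ![u, v] ↔ u ≠ v ∧ IsSimplex X.complex {u, v} := by
  rw [isOrdered_vecCons, image_vecCons]
  simp [Function.injective_of_subsingleton]

theorem eval_d_pair (φ : X.Cochain 1) (u v : V) (h : X.IsOrdered ![u, v]) :
    X.eval (X.d 1 φ) ![u, v] = X.eval φ ![v] - X.eval φ ![u] := by
  rw [eval_d_vecCons φ u ![v] h]
  have : (![v] ∘ Fin.succ : Fin 0 → V) = ![] := Subsingleton.elim _ _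
  simp [this]

/-- On a connected complex, closed `0`-forms are constant. -/
theorem eval_eq_of_d_eq_zero (hconn : IsConnectedComplex X.complex) {φ : X.Cochain 1}
    (hφ : X.d 1 φ = 0) : ∃ c, ∀ v, X.IsOrdered ![v] → X.eval φ ![v] = c := by
  obtain ⟨v₀⟩ := hconn.nonempty
  refine ⟨X.eval φ ![v₀.1], fun v hv => ?_⟩
  have hv' : {v} ∈ X.complex.faces :=
    ((isOrdered_singleton v).mp hv).resolve_left (Finset.singleton_ne_empty v)
  obtain ⟨w⟩ := hconn.preconnected ⟨v, hv'⟩ v₀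
  suffices H : ∀ a b : {v : V // {v} ∈ X.complex.faces}, (oneSkeleton X.complex).Walk a b →
      X.eval φ ![a.1] = X.eval φ ![b.1] from H _ _ w
  intro a b w
  induction w with
  | nil => rfl
  | cons h _ ih =>
    rw [← ih]
    have hne := h.1
    have h1 := eval_d_pair φ _ _ ((isOrdered_pair _ _).mpr
      ⟨fun h' => hne (Subtype.ext h'), Or.inr h.2⟩)
    rw [hφ] at h1
    have h0 : ∀ t : Fin 2 → V, X.eval (0 : X.Cochain 2) t = 0 := fun t => by
      have := eval_smul (0 : ℝ) (0 : X.Cochain 2) t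
      rwa [zero_mul, zero_smul] at this
    rw [h0] at h1
    linarith

theorem hasGap_of_spectrum (hX : 1 ≤ X.dim) (hconn : IsConnectedComplex X.complex) {l u : ℝ}
    (h : spectrum ℝ (X.upperLaplacian 0) \ {0} ⊆ Set.Icc l u) : X.HasGap l u := by
  intro g hg
  have hF : ∀ (π : Equiv.Perm (Fin 1)) (t : Fin 1 → V),
      g ((t ∘ π) 0) = ((Equiv.Perm.sign π : ℤ) : ℝ) * g (t 0) := by
    intro π t
    rw [Subsingleton.elim π 1]
    simp
  set φ : X.Cochain 1 := ofTuples (fun t => g (t 0)) hF with hφ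
  have h1 : ∀ v, X.IsOrdered ![v] → X.eval φ ![v] = g v := fun v hv => by
    rw [hφ, eval_ofTuples _ _ hv]
    rfl
  have hN : inner ℝ φ φ = ∑ v, X.tupleWeight ![v] * (g v * g v) := by
    rw [inner_zeroForm]
    refine Finset.sum_congr rfl fun v _ => ?_
    by_cases hv : X.IsOrdered ![v]
    · rw [h1 v hv]
    · rw [tupleWeight_of_not hv, zero_mul, zero_mul]
  have hQ : inner ℝ (X.upperLaplacian 0 φ) φ = ∑ v, X.tupleWeight ![v] * (g v * g v)
      - ∑ v, ∑ u, X.tupleWeight ![u, v] * (g u * g v) := by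
    rw [inner_upperLaplacian, inner_d_zeroForm hX, ← inner_zeroForm, hN]
    congr 1
    refine Finset.sum_congr rfl fun v _ => Finset.sum_congr rfl fun u _ => ?_
    by_cases huv : X.tupleWeight ![u, v] = 0
    · rw [huv, zero_mul, zero_mul]
    · have ha : X.IsOrdered ![u, v] := by
        by_contra hc
        exact huv (tupleWeight_of_not hc)
      have hb : X.IsOrdered ![v, u] := by
        by_contra hc
        exact huv ((tupleWeight_vecCons_comm v u ![]).trans (tupleWeight_of_not hc))
      rw [h1 u hb.of_vecCons, h1 v ha.of_vecCons]
  rw [← hQ, ← hN]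
  refine (upperLaplacian_isSymmetric 0).rayleigh_mem_Icc h fun z hz => ?_
  have hdz : X.d 1 z = 0 := by
    have : z ∈ LinearMap.ker (X.upperLaplacian 0) := hz
    rwa [ker_upperLaplacian] at this
  obtain ⟨c, hc⟩ := eval_eq_of_d_eq_zero hconn hdz
  rw [inner_zeroForm]
  trans c * ∑ v, X.tupleWeight ![v] * g v
  · rw [Finset.mul_sum]
    refine Finset.sum_congr rfl fun v _ => ?_
    by_cases hv : X.IsOrdered ![v]
    · rw [h1 v hv, hc v hv]
      ring
    · rw [tupleWeight_of_not hv, zero_mul, zero_mul, mul_zero]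
  · rw [hg, mul_zero]

/-- The gap inequalities without the mean-zero assumption: subtracting the mean of `g` does not
change its energy. -/
theorem HasGap.of_mean (hX : 1 ≤ X.dim) {l u : ℝ} (h : X.HasGap l u) (g : V → ℝ) :
    l * (∑ v, X.tupleWeight ![v] * (g v * g v)
        - (∑ v, X.tupleWeight ![v] * g v) ^ 2 / X.tupleWeight (![] : Fin 0 → V))
      ≤ ∑ v, X.tupleWeight ![v] * (g v * g v)
        - ∑ v, ∑ u, X.tupleWeight ![u, v] * (g u * g v) ∧
    ∑ v, X.tupleWeight ![v] * (g v * g v) - ∑ v, ∑ u, X.tupleWeight ![u, v] * (g u * g v)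
      ≤ u * (∑ v, X.tupleWeight ![v] * (g v * g v)
        - (∑ v, X.tupleWeight ![v] * g v) ^ 2 / X.tupleWeight (![] : Fin 0 → V)) := by
  set w := X.tupleWeight (![] : Fin 0 → V) with hw
  have hw0 : w ≠ 0 := (tupleWeight_pos isOrdered_empty).ne'
  set N := ∑ v, X.tupleWeight ![v] * (g v * g v) with hN
  set M := ∑ v, X.tupleWeight ![v] * g v with hM
  set Q := ∑ v, ∑ u, X.tupleWeight ![u, v] * (g u * g v) with hQ
  have hsum1 : ∑ v, X.tupleWeight ![v] = w := sum_tupleWeight_vecCons (Nat.zero_le _) ![]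
  have hsum2 : ∀ v, ∑ u, X.tupleWeight ![u, v] = X.tupleWeight ![v] :=
    fun v => sum_tupleWeight_vecCons hX ![v]
  have hM1 : ∑ v, ∑ u, X.tupleWeight ![u, v] * g v = M :=
    Finset.sum_congr rfl fun v _ => by rw [← Finset.sum_mul, hsum2]
  have hM2 : ∑ v, ∑ u, X.tupleWeight ![u, v] * g u = M := by
    rw [← hM1, Finset.sum_comm]
    exact Finset.sum_congr rfl fun v _ => Finset.sum_congr rfl fun u _ => by
      rw [tupleWeight_vecCons_comm u v ![]]
  set c := M / w with hc
  have hcw : c * w = M := div_mul_cancel₀ M hw0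
  have h1 : ∑ v, X.tupleWeight ![v] * (g v - c) = 0 := by
    simp only [mul_sub, Finset.sum_sub_distrib, ← Finset.sum_mul, hsum1]
    rw [← hM]
    linarith
  have h2 : ∑ v, X.tupleWeight ![v] * ((g v - c) * (g v - c)) = N - M ^ 2 / w := by
    have : ∀ v, X.tupleWeight ![v] * ((g v - c) * (g v - c)) = X.tupleWeight ![v] * (g v * g v)
        - 2 * c * (X.tupleWeight ![v] * g v) + X.tupleWeight ![v] * c ^ 2 := fun v => by ring
    simp only [this, Finset.sum_sub_distrib, Finset.sum_add_distrib, ← Finset.sum_mul,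
      ← Finset.mul_sum, hsum1]
    rw [← hM, ← hN, ← hcw]
    field_simp
    ring
  have h3 : ∑ v, ∑ u, X.tupleWeight ![u, v] * ((g u - c) * (g v - c)) = Q - M ^ 2 / w := by
    have : ∀ u v, X.tupleWeight ![u, v] * ((g u - c) * (g v - c))
        = X.tupleWeight ![u, v] * (g u * g v) - c * (X.tupleWeight ![u, v] * g u)
          - c * (X.tupleWeight ![u, v] * g v) + X.tupleWeight ![u, v] * c ^ 2 :=
      fun u v => by ring
    simp only [this, Finset.sum_sub_distrib, Finset.sum_add_distrib, ← Finset.mul_sum, hM2,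
      ← Finset.sum_mul, hsum2, hsum1]
    rw [← hQ, ← hM, ← hcw]
    field_simp
    ring
  have h4 := h (fun v => g v - c) h1
  simp only [h2, h3] at h4
  rwa [sub_sub_sub_cancel_right] at h4

/-! ### Links -/

theorem link_empty (h : IsSimplex X.complex ∅) (hc : (∅ : Finset V).card ≤ X.dim) :
    X.link ∅ h hc = X := by
  refine eq_of_fields (by simp [link]) ?_ (by simp [link])
  apply PreAbstractSimplicialComplex.ext
  ext σ
  simp only [link, linkComplex, Set.mem_ofPred_eq, Finset.empty_union, Finset.disjoint_empty_left,
    true_and]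
  exact ⟨fun h => h.2, fun h => ⟨(X.complex.isRelLowerSet_faces h).1, h⟩⟩

theorem link_link {τ σ : Finset V} (hτ : IsSimplex X.complex τ) (hc : τ.card ≤ X.dim)
    (hσ : IsSimplex (X.link τ hτ hc).complex σ) (hc' : σ.card ≤ (X.link τ hτ hc).dim)
    (hτσ : IsSimplex X.complex (τ ∪ σ)) (hc'' : (τ ∪ σ).card ≤ X.dim) :
    (X.link τ hτ hc).link σ hσ hc' = X.link (τ ∪ σ) hτσ hc'' := by
  have hd : Disjoint τ σ := ((isSimplex_linkComplex hτ σ).mp hσ).1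
  refine eq_of_fields ?_ ?_ ?_
  · change X.dim - τ.card - σ.card = X.dim - (τ ∪ σ).card
    rw [Finset.card_union_of_disjoint hd]
    omega
  · apply PreAbstractSimplicialComplex.ext
    ext ρ
    simp only [link, linkComplex, Set.mem_ofPred_eq, Finset.disjoint_union_left,
      Finset.disjoint_union_right, Finset.union_assoc]
    constructor
    · rintro ⟨h1, h2, h3, ⟨h4, h5⟩, h6⟩
      exact ⟨h1, ⟨h5, h2⟩, h6⟩
    · rintro ⟨h1, ⟨h5, h2⟩, h6⟩
      exact ⟨h1, h2, h1.mono Finset.subset_union_right, ⟨hd, h5⟩, h6⟩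
  · funext ρ
    simp [link, Finset.union_assoc]

theorem LinksConnected.connected (hX : 1 ≤ X.dim) (h : X.LinksConnected) :
    IsConnectedComplex X.complex := by
  have h1 := h ∅ (Or.inl rfl) (by rw [Finset.card_empty]; omega)
  have h2 := link_empty (X := X) (Or.inl rfl) (by simp)
  rw [← h2]
  exact h1

theorem LinksConnected.link (h : X.LinksConnected) {τ : Finset V} (hτ : IsSimplex X.complex τ)
    (hc : τ.card ≤ X.dim) : (X.link τ hτ hc).LinksConnected := by
  intro σ hσ hcσ
  obtain ⟨hd, hu⟩ := (isSimplex_linkComplex hτ σ).mp hσ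
  have hcard := Finset.card_union_of_disjoint hd
  have hdim : (X.link τ hτ hc).dim = X.dim - τ.card := rfl
  have h1 := h (τ ∪ σ) hu (by omega)
  have h2 := link_link hτ hc hσ (by omega) hu (by omega)
  have h3 := congrArg WeightedComplex.complex h2
  change linkComplex (X.link τ hτ hc).complex σ = linkComplex X.complex (τ ∪ σ) at h3
  rw [h3]
  exact h1

theorem OneDimLinksSpectrumIn.link {S : Set ℝ} (h : X.OneDimLinksSpectrumIn S) {τ : Finset V}
    (hτ : IsSimplex X.complex τ) (hc : τ.card ≤ X.dim) :
    (X.link τ hτ hc).OneDimLinksSpectrumIn S := by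
  intro σ hσ hcσ
  obtain ⟨hd, hu⟩ := (isSimplex_linkComplex hτ σ).mp hσ
  have hcard := Finset.card_union_of_disjoint hd
  have hdim : (X.link τ hτ hc).dim = X.dim - τ.card := rfl
  have h1 := link_link hτ hc hσ (by omega) hu (by omega)
  exact (congrArg (fun Y : WeightedComplex V => spectrum ℝ (Y.upperLaplacian 0) \ {0} ⊆ S)
    h1).mpr (h (τ ∪ σ) hu (by omega))

theorem tupleWeight_link {j : ℕ} {t : Fin j → V} (ht : X.IsOrdered t)
    (hc : (Finset.univ.image t).card ≤ X.dim) :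
    (X.link _ ht.2 hc).tupleWeight (![] : Fin 0 → V) = X.tupleWeight t ∧
    (∀ v, (X.link _ ht.2 hc).tupleWeight ![v] = X.tupleWeight (Matrix.vecCons v t)) ∧
    (∀ u v, (X.link _ ht.2 hc).tupleWeight ![u, v]
      = X.tupleWeight (Matrix.vecCons u (Matrix.vecCons v t))) := by
  have key : ∀ {i i' : ℕ} (s : Fin i → V) (s' : Fin i' → V),
      ((X.link _ ht.2 hc).IsOrdered s ↔ X.IsOrdered s') →
      Finset.univ.image t ∪ Finset.univ.image s = Finset.univ.image s' →
      (X.link _ ht.2 hc).tupleWeight s = X.tupleWeight s' := by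
    intro i i' s s' h1 h2
    by_cases h : X.IsOrdered s'
    · rw [tupleWeight, tupleWeight, if_pos h, if_pos (h1.mpr h), ← h2]
      rfl
    · rw [tupleWeight_of_not h, tupleWeight_of_not (by rwa [h1])]
  have hl : ∀ σ, IsSimplex (X.link _ ht.2 hc).complex σ ↔ Disjoint (Finset.univ.image t) σ ∧
      IsSimplex X.complex (Finset.univ.image t ∪ σ) := isSimplex_linkComplex ht.2
  refine ⟨key _ _ ?_ ?_, fun v => key _ _ ?_ ?_, fun u v => key _ _ ?_ ?_⟩
  · exact iff_of_true isOrdered_empty ht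
  · simp
  · rw [isOrdered_singleton, isOrdered_vecCons, hl, Finset.disjoint_singleton_right,
      Finset.union_comm, ← Finset.insert_eq]
    exact and_congr_right fun _ => ⟨fun h => ⟨ht.1, h⟩, fun h => h.2⟩
  · rw [image_vecCons, image_vecCons, Finset.union_comm]
    simp
  · have hset : Finset.univ.image t ∪ {u, v} = insert u (insert v (Finset.univ.image t)) := by
      rw [Finset.union_comm, Finset.insert_union, ← Finset.insert_eq]
    rw [isOrdered_pair, isOrdered_vecCons, image_vecCons, hl, hset, Matrix.vecCons,
      Fin.cons_injective_iff, Finset.disjoint_insert_right, Finset.disjoint_singleton_right,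
      Finset.mem_insert, not_or]
    have := ht.1
    simp only [Finset.mem_image, Finset.mem_univ, true_and, Set.mem_range]
    tauto
  · rw [image_vecCons, image_vecCons, image_vecCons, image_vecCons, Finset.union_comm]
    simp [Finset.insert_union]

/-- The gap inequalities of the link of the simplex spanned by `t`, written on `X`. If `t` is not an
ordered simplex, both sides vanish. -/
theorem HasGap.of_link {j : ℕ} (hj : j < X.dim) {l u : ℝ} (t : Fin j → V)
    (h : ∀ (ht : X.IsOrdered t) (hc : (Finset.univ.image t).card ≤ X.dim),
      (X.link _ ht.2 hc).HasGap l u) (g : V → ℝ) :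
    l * (∑ v, X.tupleWeight (Matrix.vecCons v t) * (g v * g v)
        - (∑ v, X.tupleWeight (Matrix.vecCons v t) * g v) ^ 2 / X.tupleWeight t)
      ≤ ∑ v, X.tupleWeight (Matrix.vecCons v t) * (g v * g v)
        - ∑ v, ∑ u, X.tupleWeight (Matrix.vecCons u (Matrix.vecCons v t)) * (g u * g v) ∧
    ∑ v, X.tupleWeight (Matrix.vecCons v t) * (g v * g v)
        - ∑ v, ∑ u, X.tupleWeight (Matrix.vecCons u (Matrix.vecCons v t)) * (g u * g v)
      ≤ u * (∑ v, X.tupleWeight (Matrix.vecCons v t) * (g v * g v)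
        - (∑ v, X.tupleWeight (Matrix.vecCons v t) * g v) ^ 2 / X.tupleWeight t) := by
  by_cases ht : X.IsOrdered t
  · have hcard := card_image_of_isOrdered ht
    have hdim : ∀ hc, (X.link (Finset.univ.image t) ht.2 hc).dim
      = X.dim - (Finset.univ.image t).card := fun _ => rfl
    have hc : (Finset.univ.image t).card ≤ X.dim := by omega
    have h1 := (h ht hc).of_mean (by rw [hdim]; omega) g
    obtain ⟨e1, e2, e3⟩ := tupleWeight_link ht hc
    simpa only [e1, e2, e3] using h1
  · have h1 : ∀ v, X.tupleWeight (Matrix.vecCons v t) = 0 :=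
      fun v => tupleWeight_of_not fun hv => ht hv.of_vecCons
    have h2 : ∀ u v, X.tupleWeight (Matrix.vecCons u (Matrix.vecCons v t)) = 0 :=
      fun u v => tupleWeight_of_not fun hv => ht hv.of_vecCons.of_vecCons
    simp [h1, h2]

end WeightedComplex

/-! ### The map `x ↦ 2 - 1 / x` -/

/-- The map `x ↦ 2 - 1 / x` sends `m / (m + 1)` to `(m - 1) / m`, and is increasing on positive
numbers. -/
theorem two_sub_inv_iterate_gt {e : ℕ} {x : ℝ} (j : ℕ)
    (hx : ((e : ℝ) + j) / (e + j + 1) < x) :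
    (e : ℝ) / (e + 1) < (fun y : ℝ => 2 - 1 / y)^[j] x := by
  induction j generalizing x with
  | zero => simpa using hx
  | succ j ih =>
    rw [Function.iterate_succ_apply]
    apply ih
    push_cast at hx
    have h1 : (0 : ℝ) < (e : ℝ) + j + 1 := by positivity
    have h2 : (0 : ℝ) < (e : ℝ) + (j + 1) + 1 := by positivity
    have h3 : (0 : ℝ) < ((e : ℝ) + (j + 1)) / (e + (j + 1) + 1) := by positivity
    have h4 := one_div_lt_one_div_of_lt h3 hx
    have h5 : 1 / (((e : ℝ) + (j + 1)) / (e + (j + 1) + 1)) = 2 - (e + j) / (e + j + 1) := by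
      rw [one_div_div, ← add_assoc]
      field_simp
      ring
    linarith

namespace WeightedComplex

variable {V : Type*} [Fintype V] [DecidableEq V] {X : WeightedComplex V}

/-! ### Descent of spectral gaps -/

/-- An eigenform `φ` of `Δ₀⁺` with eigenvalue `α` satisfies `Aφ = (1 - α) φ`, where `A` is the
weighted adjacency operator. -/
theorem sum_pair_of_eigenform (hX : 1 ≤ X.dim) {α : ℝ} {φ : X.Cochain 1}
    (h : X.upperLaplacian 0 φ = α • φ) (v : V) :
    ∑ u, X.tupleWeight ![u, v] * X.eval φ ![u]
      = X.tupleWeight ![v] * ((1 - α) * X.eval φ ![v]) := by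
  have h1 := tupleWeight_mul_eval_codifferential (X.d 1 φ) ![v]
  have h2 : X.codifferential 1 (X.d 1 φ) = α • φ := h
  rw [h2, eval_smul] at h1
  have h3 : ∀ u, X.tupleWeight ![u, v] * X.eval (X.d 1 φ) ![u, v]
      = X.tupleWeight ![u, v] * X.eval φ ![v] - X.tupleWeight ![u, v] * X.eval φ ![u] := by
    intro u
    by_cases hu : X.IsOrdered ![u, v]
    · rw [eval_d_pair φ u v hu]
      ring
    · simp [tupleWeight_of_not hu]
  have h4 : ∑ u, X.tupleWeight ![u, v] = X.tupleWeight ![v] := sum_tupleWeight_vecCons hX ![v]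
  simp only [h3, Finset.sum_sub_distrib, ← Finset.sum_mul, h4] at h1
  linarith

/-- Descent of spectral gaps from the links of vertices. For an eigenform `φ` of `Δ₀⁺` with
eigenvalue `α`, the energies of the restrictions of `φ` to the links of the vertices sum up to
`‖dφ‖² = α ‖φ‖²`, their norms to `‖φ‖²`, and the norms of their means to
`‖φ - Δ₀⁺ φ‖² = (1 - α)² ‖φ‖²`; so `l α (2 - α) ≤ α ≤ u α (2 - α)`. -/
theorem spectrum_subset_of_vertex_links (hX : 2 ≤ X.dim) {l u : ℝ} (hl : 0 < l) (hu : 0 < u)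
    (h : ∀ (τ : Finset V) (hτ : IsSimplex X.complex τ) (hc : τ.card ≤ X.dim), τ.card = 1 →
      (X.link τ hτ hc).HasGap l u) :
    spectrum ℝ (X.upperLaplacian 0) \ {0} ⊆ Set.Icc (2 - 1 / l) (2 - 1 / u) := by
  rintro α ⟨hα, hα0⟩
  rw [← Module.End.hasEigenvalue_iff_mem_spectrum] at hα
  obtain ⟨φ, hφ⟩ := hα.exists_hasEigenvector
  have hφe : X.upperLaplacian 0 φ = α • φ := hφ.apply_eq_smul
  have hNpos : 0 < inner ℝ φ φ := real_inner_self_pos.mpr hφ.2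
  have hE : inner ℝ (X.d 1 φ) (X.d 1 φ) = α * inner ℝ φ φ := by
    rw [← inner_upperLaplacian, hφe, real_inner_smul_left]
  have hαnn : 0 ≤ α := by
    have h1 : 0 ≤ α * inner ℝ φ φ := hE ▸ real_inner_self_nonneg
    exact nonneg_of_mul_nonneg_left h1 hNpos
  have hαpos : 0 < α := lt_of_le_of_ne hαnn (Ne.symm hα0)
  have hE' := inner_d_zeroForm (by omega) φ
  rw [hE, ← inner_zeroForm] at hE'
  have hN := inner_zeroForm φ φ
  set g : V → ℝ := fun v => X.eval φ ![v] with hg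
  set N := inner ℝ φ φ with hNdef
  have hA : ∀ v, ∑ u, X.tupleWeight ![u, v] * g u = X.tupleWeight ![v] * ((1 - α) * g v) :=
    sum_pair_of_eigenform (by omega) hφe
  have hw1 : ∀ v, ∑ u, X.tupleWeight ![u, v] = X.tupleWeight ![v] :=
    fun v => sum_tupleWeight_vecCons (by omega) ![v]
  have hw2 : ∀ u v, ∑ z, X.tupleWeight ![z, u, v] = X.tupleWeight ![u, v] :=
    fun u v => sum_tupleWeight_vecCons (by omega) ![u, v]
  have hloc := fun v => HasGap.of_link (by omega) (l := l) (u := u) ![v]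
    (fun ht hc => h _ ht.2 hc (card_image_of_isOrdered ht)) g
  -- `s1`, `s2` and `s3` sum the norms, the norms of the means and the adjacency forms of the
  -- restrictions of `g` over the links of all vertices.
  have s1 : ∑ v, ∑ u, X.tupleWeight ![u, v] * (g u * g u) = N := by
    rw [Finset.sum_comm, hN]
    refine Finset.sum_congr rfl fun u _ => ?_
    rw [← hw1 u, Finset.sum_mul]
    exact Finset.sum_congr rfl fun v _ => by rw [tupleWeight_vecCons_comm u v ![]]
  have s2 : ∑ v, (∑ u, X.tupleWeight ![u, v] * g u) ^ 2 / X.tupleWeight ![v]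
      = (1 - α) ^ 2 * N := by
    rw [hN, Finset.mul_sum]
    refine Finset.sum_congr rfl fun v _ => ?_
    rw [hA]
    by_cases hv : X.tupleWeight ![v] = 0
    · simp [hv]
    · field_simp
      rfl
  have s3 : ∑ v, ∑ u, ∑ z, X.tupleWeight ![z, u, v] * (g z * g u) = N - α * N := by
    have : ∀ v u z, X.tupleWeight ![z, u, v] = X.tupleWeight ![v, z, u] := fun v u z => by
      have h1 : X.tupleWeight ![z, u, v] = X.tupleWeight ![z, v, u] := by
        have hp : ![z, u, v] = ![z, v, u] ∘ Equiv.swap 1 2 := by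
          funext i
          fin_cases i <;> simp [Equiv.swap_apply_def]
        rw [hp, tupleWeight_comp_perm]
      rw [h1]
      exact tupleWeight_vecCons_comm v z ![u]
    simp only [this]
    rw [Finset.sum_comm]
    have h2 : ∀ u, ∑ v, ∑ z, X.tupleWeight ![v, z, u] * (g z * g u)
        = ∑ z, X.tupleWeight ![z, u] * (g z * g u) := fun u => by
      rw [Finset.sum_comm]
      exact Finset.sum_congr rfl fun z _ => by rw [← Finset.sum_mul, hw2]
    simp only [h2]
    linarith
  have hlow := Finset.sum_le_sum fun v (_ : v ∈ Finset.univ) => (hloc v).1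
  have hupp := Finset.sum_le_sum fun v (_ : v ∈ Finset.univ) => (hloc v).2
  simp only [← Finset.mul_sum, Finset.sum_sub_distrib, s1, s2, s3] at hlow hupp
  have hp : 0 < α * N := mul_pos hαpos hNpos
  have k1 : l * (2 - α) ≤ 1 := by
    refine le_of_mul_le_mul_right ?_ hp
    linarith
  have k2 : 1 ≤ u * (2 - α) := by
    refine le_of_mul_le_mul_right ?_ hp
    linarith
  constructor
  · have : 2 - α ≤ 1 / l := by
      rw [le_div_iff₀ hl]
      linarith
    linarith
  · have : 1 / u ≤ 2 - α := by
      rw [div_le_iff₀ hu]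
      linarith
    linarith

/-- Iterated descent, from the links of dimension one to a complex of dimension `d + 1`. -/
theorem hasGap_of_oneDimLinks {lam kap : ℝ} (hle : lam ≤ kap) (d : ℕ) (X : WeightedComplex V)
    (hd : X.dim = d + 1) (hconn : X.LinksConnected) (hlam : (d : ℝ) / (d + 1) < lam)
    (hgap : X.OneDimLinksSpectrumIn (Set.Icc lam kap)) :
    X.HasGap ((fun y : ℝ => 2 - 1 / y)^[d] lam) ((fun y : ℝ => 2 - 1 / y)^[d] kap) := by
  induction d generalizing X with
  | zero =>
    refine hasGap_of_spectrum (by omega) (hconn.connected (by omega)) ?_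
    have h1 := link_empty (X := X) (Or.inl rfl) (by simp)
    exact (congrArg (fun Y : WeightedComplex V =>
      spectrum ℝ (Y.upperLaplacian 0) \ {0} ⊆ Set.Icc lam kap) h1).mp
        (hgap ∅ (Or.inl rfl) (by rw [Finset.card_empty]; omega))
  | succ d ih =>
    push_cast at hlam
    have hlam' : (d : ℝ) / (d + 1) < lam := by
      refine lt_of_le_of_lt ?_ hlam
      rw [div_le_div_iff₀ (by positivity) (by positivity)]
      linarith
    have hpos : ∀ x, lam ≤ x → 0 < (fun y : ℝ => 2 - 1 / y)^[d] x := by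
      intro x hx
      have := two_sub_inv_iterate_gt (e := 0) (x := x) d
        (by simpa using hlam'.trans_le hx)
      simpa using this
    rw [Function.iterate_succ_apply', Function.iterate_succ_apply']
    refine hasGap_of_spectrum (by omega) (hconn.connected (by omega))
      (spectrum_subset_of_vertex_links (by omega) (hpos _ le_rfl) (hpos _ hle)
        fun τ hτ hc hτ1 => ?_)
    have hdim : (X.link τ hτ hc).dim = X.dim - τ.card := rfl
    exact ih _ (by omega) (hconn.link hτ hc) hlam' (hgap.link hτ hc)

/-! ### Localization of forms of higher degree -/

/-- Garland's method: on coclosed `k`-forms, the energy is controlled by the gaps of the links of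
the simplices with `k` vertices. -/
theorem inner_d_self_of_links {k : ℕ} (hk : k < X.dim) {l u : ℝ}
    (h : ∀ (τ : Finset V) (hτ : IsSimplex X.complex τ) (hc : τ.card ≤ X.dim), τ.card = k →
      (X.link τ hτ hc).HasGap l u) {φ : X.Cochain (k + 1)} (hφ : X.codifferential k φ = 0) :
    (((k : ℝ) + 1) * l - k) * inner ℝ φ φ ≤ inner ℝ (X.d (k + 1) φ) (X.d (k + 1) φ) ∧
    inner ℝ (X.d (k + 1) φ) (X.d (k + 1) φ) ≤ (((k : ℝ) + 1) * u - k) * inner ℝ φ φ := by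
  have hE := inner_d_self (by omega) φ
  have hN := inner_eq_sum_tuples φ φ
  rw [Nat.factorial_succ, sum_vecCons] at hN
  push_cast at hN
  have hfac : (0 : ℝ) < k.factorial := by positivity
  have hmean : ∀ t : Fin k → V,
      ∑ v, X.tupleWeight (Matrix.vecCons v t) * X.eval φ (Matrix.vecCons v t) = 0 := by
    intro t
    rw [← tupleWeight_mul_eval_codifferential, hφ]
    have := eval_smul (0 : ℝ) (0 : X.Cochain k) t
    rw [zero_mul, zero_smul] at this
    rw [this, mul_zero]
  have hloc := fun t : Fin k → V => HasGap.of_link hk (l := l) (u := u) t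
    (fun ht hc => h _ ht.2 hc (card_image_of_isOrdered ht))
    (fun v => X.eval φ (Matrix.vecCons v t))
  simp only [mul_assoc] at hE hN
  have hlow := Finset.sum_le_sum fun t (_ : t ∈ Finset.univ) => (hloc t).1
  have hupp := Finset.sum_le_sum fun t (_ : t ∈ Finset.univ) => (hloc t).2
  simp only [hmean, ← Finset.mul_sum, Finset.sum_sub_distrib, ← hN, ne_eq, OfNat.ofNat_ne_zero,
    not_false_eq_true, zero_pow, zero_div, sub_zero] at hlow hupp
  constructor
  · refine le_of_mul_le_mul_left ?_ hfac
    linarith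
  · refine le_of_mul_le_mul_left ?_ hfac
    linarith

variable (X) in
theorem exists_oneDimLinksSpectrumIn_Iic : ∃ b, X.OneDimLinksSpectrumIn (Set.Iic b) := by
  have hfin : (⋃ (τ : Finset V), ⋃ (hτ : IsSimplex X.complex τ), ⋃ (hc : τ.card + 1 = X.dim),
      spectrum ℝ ((X.link τ hτ (by omega)).upperLaplacian 0)).Finite :=
    Set.finite_iUnion fun τ => Set.finite_iUnion fun hτ => Set.finite_iUnion fun hc =>
      Module.End.finite_spectrum _
  obtain ⟨b, hb⟩ := hfin.bddAbove
  refine ⟨b, fun τ hτ hc α hα => hb ?_⟩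
  simp only [Set.mem_iUnion]
  exact ⟨τ, hτ, hc, hα.1⟩

end WeightedComplex

theorem tendsto_spectralBound (n k : ℕ) : Filter.Tendsto (spectralBound n k) (𝓝 1) (𝓝 1) := by
  have h1 : ∀ j : ℕ, Filter.Tendsto (fun y : ℝ => 2 - 1 / y)^[j] (𝓝 1) (𝓝 1) := by
    intro j
    induction j with
    | zero => exact Filter.tendsto_id
    | succ j ih =>
      rw [Function.iterate_succ]
      refine ih.comp ?_
      have h2 : ContinuousAt (fun y : ℝ => 2 - 1 / y) 1 :=
        continuousAt_const.sub (continuousAt_const.div continuousAt_id one_ne_zero)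
      have h3 := h2.tendsto
      norm_num at h3 ⊢
      exact h3
  have h2 := ((h1 (n - 1 - k)).const_mul ((k : ℝ) + 1)).sub_const (k : ℝ)
  have h3 : ((k : ℝ) + 1) * 1 - k = 1 := by ring
  rw [h3] at h2
  exact h2

theorem theorem2p1 {V : Type*} [Fintype V] [DecidableEq V] (X : WeightedComplex V) (n : ℕ)
    (hdim : X.dim = n) (hn : 1 ≤ n) (hconn : X.LinksConnected)
    (lam : ℝ) (hlam : ((n : ℝ) - 1) / n < lam)
    (hgap : X.OneDimLinksSpectrumIn (Set.Ici lam))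
    (k : ℕ) (hk : k < n) :
    Subsingleton (X.ReducedCohomology k) ∧
    IsCompl (LinearMap.ker (X.upperLaplacian k)) (LinearMap.ker (X.lowerLaplacian k)) ∧
    (LinearMap.ker (X.upperLaplacian k)) ⟂ (LinearMap.ker (X.lowerLaplacian k)) ∧
    spectrum ℝ (X.upperLaplacian k) \ {0} ⊆ Set.Ici (spectralBound n k lam) ∧
    spectrum ℝ (X.lowerLaplacian (k + 1)) \ {0} ⊆ Set.Ici (spectralBound n k lam) ∧
    (∀ kap : ℝ, lam ≤ kap → X.OneDimLinksSpectrumIn (Set.Icc lam kap) →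
      spectrum ℝ (X.upperLaplacian k) \ {0} ⊆
        Set.Icc (spectralBound n k lam) (spectralBound n k kap) ∧
      spectrum ℝ (X.lowerLaplacian (k + 1)) \ {0} ⊆
        Set.Icc (spectralBound n k lam) (spectralBound n k kap)) ∧
    Filter.Tendsto (spectralBound n k) (𝓝 1) (𝓝 1) := by
  obtain ⟨e, rfl⟩ : ∃ e, n = k + e + 1 := ⟨n - 1 - k, by omega⟩
  have he : k + e + 1 - 1 - k = e := by omega
  push_cast at hlam
  rw [add_sub_cancel_right] at hlam
  have hlam_e : (e : ℝ) / (e + 1) < lam := by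
    refine lt_of_le_of_lt ?_ hlam
    rw [div_le_div_iff₀ (by positivity) (by positivity)]
    have : (0 : ℝ) ≤ k := by positivity
    nlinarith
  have main : ∀ kap, lam ≤ kap → X.OneDimLinksSpectrumIn (Set.Icc lam kap) →
      ∀ φ : X.Cochain (k + 1), X.codifferential k φ = 0 →
        spectralBound (k + e + 1) k lam * inner ℝ φ φ
          ≤ inner ℝ (X.d (k + 1) φ) (X.d (k + 1) φ) ∧
        inner ℝ (X.d (k + 1) φ) (X.d (k + 1) φ)
          ≤ spectralBound (k + e + 1) k kap * inner ℝ φ φ := by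
    intro kap hle hS φ hφ
    rw [spectralBound, spectralBound, he]
    refine WeightedComplex.inner_d_self_of_links (by omega) (fun τ hτ hc hcard => ?_) hφ
    have hd : (X.link τ hτ hc).dim = X.dim - τ.card := rfl
    exact WeightedComplex.hasGap_of_oneDimLinks hle e _ (by omega) (hconn.link hτ hc) hlam_e
      (hS.link hτ hc)
  -- The spectra of the finitely many links are bounded above, so the one-sided hypothesis
  -- is an instance of the two-sided one.
  obtain ⟨b, hb⟩ := X.exists_oneDimLinksSpectrumIn_Iic
  have hmax := main (max lam b) (le_max_left _ _) fun τ hτ hc α hα =>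
    ⟨hgap τ hτ hc hα, (hb τ hτ hc hα).trans (le_max_right _ _)⟩
  have hpos : 0 < spectralBound (k + e + 1) k lam := by
    have h1 := two_sub_inv_iterate_gt (e := k) e hlam
    rw [div_lt_iff₀ (by positivity)] at h1
    rw [spectralBound, he]
    linarith
  have hker := WeightedComplex.ker_d_eq_range_d hpos fun φ hφ => (hmax φ hφ).1
  have hspec := WeightedComplex.spectrum_upperLaplacian_subset hmax
  refine ⟨?_, WeightedComplex.isCompl_ker_laplacians hker,
    WeightedComplex.isOrtho_ker_laplacians hker, hspec.trans Set.Icc_subset_Ici_self,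
    (WeightedComplex.spectrum_lowerLaplacian_subset k).trans
      (hspec.trans Set.Icc_subset_Ici_self), fun kap hle hS => ?_, tendsto_spectralBound _ _⟩
  · rw [Submodule.Quotient.subsingleton_iff, Submodule.submoduleOf,
      Submodule.comap_subtype_eq_top]
    exact hker.le
  · have h1 := WeightedComplex.spectrum_upperLaplacian_subset (main kap hle hS)
    exact ⟨h1, (WeightedComplex.spectrum_lowerLaplacian_subset k).trans h1⟩
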